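/- **Setting.** All sesquilinear maps and inner products are antilinear in the first and linear in the second variable. Let $\mathcal N$ be a $W^*$-algebra, i.e. a unital $C^*$-algebra with a Banach predual $\mathcal N_*$, and let $\tau$ be a normal (weak-$*$ lower semicontinuous), faithful, semi-finite trace on $\mathcal N_+$ (semi-finite: the span of the positive elements of finite trace is weak-$*$ dense). Let $\mathfrak n=\{a\in\mathcal N:\tau(a^*a)<\infty\}$ and let $L^2(\tau)$ be the completion of $\mathfrak n$ for $\langle a,b\rangle=\tau(a^*b)$. Let $(P_t)_{t\ge 0}$ be a Markov semigroup on $\mathcal N$: each $P_t:\mathcal N\to\mathcal N$ is linear, completely positive, contractive and unital, $P_0=\mathrm{id}$, $P_{s+t}=P_sP_t$, and $P_t(a)(x)\to a(x)$ as $t\to0$ for all $a\in\mathcal N$, $x\in\mathcal N_*$. Assume that $\tau$ is symmetric for it: $\tau(aP_t(b))=\tau(P_t(a)b)$ for $a,b\in\mathcal N_+$, where for positive $x,y$ one sets $\tau(xy):=\tau(x^{1/2}yx^{1/2})=\tau(y^{1/2}xy^{1/2})$. Then $P_t$ restricted to $\mathfrak n$ extends to a self-adjoint contraction of $L^2(\tau)$,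 again denoted $P_t$. The associated Dirichlet form is $$\mathcal E[f]=\lim_{t\searrow0}\tfrac1t\langle f,f-P_tf\rangle=\sup_{t>0}\tfrac1t\langle f,f-P_tf\rangle\in[0,\infty],\qquad D(\mathcal E)=\{f\in L^2(\tau):\mathcal E[f]<\infty\},$$ and $\mathcal E(f,g)$ denotes the corresponding sesquilinear form on $D(\mathcal E)$. Let $\mathcal A\subseteq\mathcal N$ be a regular $C^*$-subalgebra: a norm-closed, not necessarily unital $*$-subalgebra such that $\tau|_{\mathcal A}$ is semi-finite for the norm (the span of the positive elements of $\mathcal A$ of finite trace is norm dense in $\mathcal A$), $\mathcal A\cap\mathfrak n$ is norm dense in $\mathcal A$, and $\mathcal B:=\mathcal A\cap D(\mathcal E)$ is norm dense in $\mathcal A$ and is dense in $D(\mathcal E)$ for the norm $(\|f\|_{L^2}^2+\mathcal E[f])^{1/2}$. Then $\mathcal B$ is a $*$-algebra. The Cipriani–Sauvageot tangent space $\mathcal H$ is the Hilbert space obtained from $\mathcal B\otimes\mathcal B$ (algebraic tensor product over $\mathbb C$), with the positive semi-definite form given by $$\langle a\otimes b,c\otimes d\rangle_{\mathcal H}=\tfrac12\bigl(\mathcal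 E(a,cdb^*)+\mathcal E(abd^*,c)-\mathcal E(bd^*,a^*c)\bigr),$$ by dividing by the null space and completing. It is a right $\mathcal A$-module by the continuous extension of $(a\otimes b)f=a\otimes(bf)$, $f\in\mathcal B$. For $a\in\mathcal B$ there is a unique $\partial a\in\mathcal H$ with $(\partial a)b=a\otimes b$ for all $b\in\mathcal B$, and the carré du champ $\Gamma(a,c)\in\mathcal A^*$ is $\Gamma(a,c)(f)=\langle\partial a,(\partial c)f\rangle_{\mathcal H}$, $f\in\mathcal A$. The Banach dual $\mathcal A^*$ is an $\mathcal A$-bimodule by $(a\,m)(f)=m(fa)$, $(m\,c)(f)=m(cf)$, and $1_{\mathcal A^{**}}$ denotes the identity element of the $W^*$-algebra $\mathcal A^{**}$ (the two-sided identity of the Arens product). For $a,b,c,d\in\mathcal B$ put $$\hat R(a\otimes b,c\otimes d):=b^*\,\Gamma(a,c)\,d\in\mathcal A^*.$$ **Theorem.** $\hat R$ extends to a well-defined continuous sesquilinear map $R:\mathcal H\times\mathcal H\to\mathcal A^*$, i.e. $R(a\otimes b,c\otimes d)=\hat R(a\otimes b,c\otimes d)$ for all $a,b,c,d\in\mathcal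 B$, such that: 1. for every $h\in\mathcal H$ the functional $R[h]:=R(h,h)$ is positive: $R(h,h)(f^*f)\ge0$ for all $f\in\mathcal A$; 2. $1_{\mathcal A^{**}}(R(h,g))=\langle h,g\rangle_{\mathcal H}$ for all $h,g\in\mathcal H$. The extension is unique: $R$ is the only continuous sesquilinear extension of $\hat R$ to $\mathcal H\times\mathcal H$, and it is also the only sesquilinear extension of $\hat R$ (continuous or not) that satisfies 1 and 2. -/

import Mathlib

noncomputable section

open scoped ENNReal NNReal Topology ComplexConjugate InnerProductSpace CStarAlgebra TensorProduct
open Filter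

/-- A normal, faithful, semi-finite trace on the W*-algebra `N` with predual `X`. Only the values
of the underlying function on the positive cone of `N` are ever used. -/
structure NFSTrace (N : Type*) [CStarAlgebra N] [PartialOrder N] [StarOrderedRing N]
    {X : Type*} [NormedAddCommGroup X] [NormedSpace ℂ X]
    (pre : StrongDual ℂ X ≃ₗᵢ[ℂ] N) where
  toFun : N → ℝ≥0∞
  map_add' : ∀ a b : N, 0 ≤ a → 0 ≤ b → toFun (a + b) = toFun a + toFun b
  map_smul' : ∀ (r : ℝ≥0) (a : N), 0 ≤ a → toFun (((r : ℝ) : ℂ) • a) = r * toFun a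
  map_star_mul' : ∀ a : N, toFun (star a * a) = toFun (a * star a)
  faithful' : ∀ a : N, 0 ≤ a → toFun a = 0 → a = 0
  /-- lower semicontinuity on the positive cone for the weak-* topology -/
  normal' : LowerSemicontinuousOn
    (fun φ : WeakDual ℂ X => toFun (pre (WeakDual.toStrongDual φ)))
    {φ : WeakDual ℂ X | 0 ≤ pre (WeakDual.toStrongDual φ)}
  /-- the linear span of the positive elements of finite trace is weak-* dense -/
  semifinite' : Dense {φ : WeakDual ℂ X | pre (WeakDual.toStrongDual φ) ∈
    Submodule.span ℂ {a : N | 0 ≤ a ∧ toFun a < ∞}}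

namespace NFSTrace

variable {N : Type*} [CStarAlgebra N] [PartialOrder N] [StarOrderedRing N]
  {X : Type*} [NormedAddCommGroup X] [NormedSpace ℂ X] {pre : StrongDual ℂ X ≃ₗᵢ[ℂ] N}
  (τ : NFSTrace N pre)

instance : CoeFun (NFSTrace N pre) (fun _ => N → ℝ≥0∞) := ⟨NFSTrace.toFun⟩

theorem map_zero : τ 0 = 0 := by
  have := τ.map_smul' 0 0 le_rfl
  simpa using this

theorem mono {a b : N} (ha : 0 ≤ a) (hab : a ≤ b) : τ a ≤ τ b := by
  have h := τ.map_add' a (b - a) ha (sub_nonneg.2 hab)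
  rw [add_sub_cancel] at h
  rw [h]; exact le_self_add

theorem map_sum {ι : Type*} (s : Finset ι) (f : ι → N) (hf : ∀ i ∈ s, 0 ≤ f i) :
    τ (∑ i ∈ s, f i) = ∑ i ∈ s, τ (f i) := by
  classical
  induction s using Finset.induction_on with
  | empty => simp [τ.map_zero]
  | insert i s hi ih =>
    rw [Finset.sum_insert hi, Finset.sum_insert hi, τ.map_add' _ _ (hf i (by simp))
      (Finset.sum_nonneg fun j hj => hf j (by simp [hj])), ih fun j hj => hf j (by simp [hj])]

theorem map_real_smul (r : ℝ) (hr : 0 ≤ r) {a : N} (ha : 0 ≤ a) :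
    τ (r • a) = ENNReal.ofReal r * τ a := by
  have := τ.map_smul' ⟨r, hr⟩ a ha
  rw [ENNReal.ofReal, Real.toNNReal_of_nonneg hr]
  refine Eq.trans ?_ this
  exact congrArg τ.toFun (Complex.coe_smul r a).symm

theorem parallelogram (a b : N) :
    τ (star (a + b) * (a + b)) + τ (star (a - b) * (a - b)) =
      2 * τ (star a * a) + 2 * τ (star b * b) := by
  rw [← τ.map_add' _ _ (star_mul_self_nonneg _) (star_mul_self_nonneg _)]
  have : star (a + b) * (a + b) + star (a - b) * (a - b) =
      (star a * a + star a * a) + (star b * b + star b * b) := by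
    simp only [star_add, star_sub]; noncomm_ring
  rw [this, τ.map_add' _ _ (add_nonneg (star_mul_self_nonneg _) (star_mul_self_nonneg _))
    (add_nonneg (star_mul_self_nonneg _) (star_mul_self_nonneg _)),
    τ.map_add' _ _ (star_mul_self_nonneg _) (star_mul_self_nonneg _),
    τ.map_add' _ _ (star_mul_self_nonneg _) (star_mul_self_nonneg _)]
  ring

theorem le_mul_left (x a : N) :
    τ (star (x * a) * (x * a)) ≤ ENNReal.ofReal (‖x‖ ^ 2) * τ (star a * a) := by
  rw [← τ.map_real_smul _ (sq_nonneg _) (star_mul_self_nonneg _)]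
  refine τ.mono (star_mul_self_nonneg _) ?_
  have := CStarAlgebra.star_left_conjugate_le_norm_smul (a := a) (b := star x * x)
    (IsSelfAdjoint.star_mul_self x)
  rw [CStarRing.norm_star_mul_self, ← sq] at this
  simpa [mul_assoc] using this

theorem star_eq (a : N) : τ (star (star a) * star a) = τ (star a * a) := by
  rw [star_star, τ.map_star_mul']

theorem le_mul_right (a x : N) :
    τ (star (a * x) * (a * x)) ≤ ENNReal.ofReal (‖x‖ ^ 2) * τ (star a * a) := by
  rw [← τ.star_eq (a * x), ← τ.star_eq a, star_mul, ← norm_star x]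
  exact τ.le_mul_left _ _

/-- The space `𝔫` of the elements `a` of `N` with `τ(a* a) < ∞`. -/
def sqInt : Submodule ℂ N where
  carrier := {a | τ (star a * a) < ∞}
  zero_mem' := by simp [τ.map_zero]
  add_mem' := by
    intro a b ha hb
    refine lt_of_le_of_lt le_self_add ((τ.parallelogram a b).trans_lt ?_)
    exact ENNReal.add_lt_top.2 ⟨ENNReal.mul_lt_top (by simp) ha, ENNReal.mul_lt_top (by simp) hb⟩
  smul_mem' := by
    intro c a ha
    have := τ.le_mul_left (c • (1 : N)) a
    rw [smul_one_mul] at this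
    exact this.trans_lt (ENNReal.mul_lt_top ENNReal.ofReal_lt_top ha)

theorem mem_sqInt {a : N} : a ∈ τ.sqInt ↔ τ (star a * a) < ∞ := Iff.rfl

theorem mul_mem_left (x : N) {a : N} (ha : a ∈ τ.sqInt) : x * a ∈ τ.sqInt :=
  (τ.le_mul_left x a).trans_lt (ENNReal.mul_lt_top ENNReal.ofReal_lt_top ha)

theorem mul_mem_right {a : N} (ha : a ∈ τ.sqInt) (x : N) : a * x ∈ τ.sqInt :=
  (τ.le_mul_right a x).trans_lt (ENNReal.mul_lt_top ENNReal.ofReal_lt_top ha)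

theorem star_mem {a : N} (ha : a ∈ τ.sqInt) : star a ∈ τ.sqInt := by
  rw [mem_sqInt, τ.star_eq]; exact ha

/-- `𝔫` as a pre-Hilbert space, with the norm `τ(a* a)^(1/2)`. -/
def PreL2 : Type _ := τ.sqInt

instance : AddCommGroup τ.PreL2 := inferInstanceAs (AddCommGroup τ.sqInt)
instance : Module ℂ τ.PreL2 := inferInstanceAs (Module ℂ τ.sqInt)

/-- The inclusion of `𝔫` into `N`. -/
def val : τ.PreL2 →ₗ[ℂ] N := τ.sqInt.subtype

/-- An element of `𝔫` as an element of the pre-Hilbert space. -/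
def ofN (a : N) (ha : a ∈ τ.sqInt) : τ.PreL2 := (⟨a, ha⟩ : τ.sqInt)

@[simp] theorem val_ofN (a : N) (ha : a ∈ τ.sqInt) : τ.val (τ.ofN a ha) = a := rfl

theorem val_mem (x : τ.PreL2) : τ.val x ∈ τ.sqInt := Subtype.property (p := (· ∈ τ.sqInt)) x

theorem val_inj {x y : τ.PreL2} (h : τ.val x = τ.val y) : x = y := Subtype.ext h

instance : Norm τ.PreL2 := ⟨fun x => √(τ (star (τ.val x) * τ.val x)).toReal⟩

theorem norm_sq (x : τ.PreL2) : ‖x‖ ^ 2 = (τ (star (τ.val x) * τ.val x)).toReal :=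
  Real.sq_sqrt ENNReal.toReal_nonneg

theorem ofReal_norm_sq (x : τ.PreL2) :
    ENNReal.ofReal (‖x‖ ^ 2) = τ (star (τ.val x) * τ.val x) := by
  rw [norm_sq, ENNReal.ofReal_toReal (τ.val_mem x).ne]

theorem norm_nonneg' (x : τ.PreL2) : 0 ≤ ‖x‖ := Real.sqrt_nonneg _

theorem norm_le_iff {x : τ.PreL2} {r : ℝ} (hr : 0 ≤ r) :
    ‖x‖ ≤ r ↔ τ (star (τ.val x) * τ.val x) ≤ ENNReal.ofReal (r ^ 2) := by
  rw [← ofReal_norm_sq, ENNReal.ofReal_le_ofReal_iff (sq_nonneg _),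
    sq_le_sq₀ (τ.norm_nonneg' x) hr]

theorem norm_add_le' (x y : τ.PreL2) : ‖x + y‖ ≤ ‖x‖ + ‖y‖ := by
  have key : ∀ s : ℝ, 0 < s → ‖x + y‖ ^ 2 ≤ (1 + s) * ‖x‖ ^ 2 + (1 + s⁻¹) * ‖y‖ ^ 2 := by
    intro s hs
    have hs' : 0 < √s := Real.sqrt_pos.2 hs
    rw [← ENNReal.ofReal_le_ofReal_iff (by positivity), ENNReal.ofReal_add (by positivity)
      (by positivity), ENNReal.ofReal_mul (by positivity), ENNReal.ofReal_mul (by positivity),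
      ofReal_norm_sq, ofReal_norm_sq, ofReal_norm_sq,
      ← τ.map_real_smul _ (by positivity) (star_mul_self_nonneg _),
      ← τ.map_real_smul _ (by positivity) (star_mul_self_nonneg _),
      ← τ.map_add' _ _ (smul_nonneg (by positivity) (star_mul_self_nonneg _))
        (smul_nonneg (by positivity) (star_mul_self_nonneg _))]
    refine τ.mono (star_mul_self_nonneg _) (sub_nonneg.1 ?_)
    set a := τ.val x
    set b := τ.val y
    have h0 := star_mul_self_nonneg (√s • a - (√s)⁻¹ • b)
    convert h0 using 1
    have e1 : √s * √s = s := Real.mul_self_sqrt hs.le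
    have e2 : (√s)⁻¹ * (√s)⁻¹ = s⁻¹ := by rw [← mul_inv, e1]
    have e3 : √s * (√s)⁻¹ = 1 := mul_inv_cancel₀ hs'.ne'
    have e4 : (√s)⁻¹ * √s = 1 := inv_mul_cancel₀ hs'.ne'
    simp only [map_add, star_add, star_sub, star_smul, star_trivial, mul_add, add_mul, mul_sub,
      sub_mul, smul_mul_smul_comm, e1, e2, e3, e4, one_smul, add_smul]
    abel
  by_cases hx : ‖x‖ = 0
  · by_contra! h
    rw [hx, zero_add] at h
    have hy := τ.norm_nonneg' y
    have h2 : ‖y‖ ^ 2 < ‖x + y‖ ^ 2 := by gcongr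
    have hd : 0 < ‖x + y‖ ^ 2 - ‖y‖ ^ 2 := by linarith
    by_cases hy0 : ‖y‖ = 0
    · have := key 1 one_pos; rw [hx, hy0] at *; nlinarith
    · have hy1 : 0 < ‖y‖ ^ 2 := by positivity
      have := key (2 * ‖y‖ ^ 2 / (‖x + y‖ ^ 2 - ‖y‖ ^ 2)) (by positivity)
      rw [hx] at this
      have e : (2 * ‖y‖ ^ 2 / (‖x + y‖ ^ 2 - ‖y‖ ^ 2))⁻¹ * ‖y‖ ^ 2 =
          (‖x + y‖ ^ 2 - ‖y‖ ^ 2) / 2 := by field_simp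
      nlinarith
  · have hx' : 0 < ‖x‖ := lt_of_le_of_ne (τ.norm_nonneg' x) (Ne.symm hx)
    by_cases hy0 : ‖y‖ = 0
    · by_contra! h
      rw [hy0, add_zero] at h
      have h2 : ‖x‖ ^ 2 < ‖x + y‖ ^ 2 := by gcongr
      have := key ((‖x + y‖ ^ 2 - ‖x‖ ^ 2) / (2 * ‖x‖ ^ 2)) (by
        apply div_pos (by linarith) (by positivity))
      rw [hy0] at this
      have e : (‖x + y‖ ^ 2 - ‖x‖ ^ 2) / (2 * ‖x‖ ^ 2) * ‖x‖ ^ 2 =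
          (‖x + y‖ ^ 2 - ‖x‖ ^ 2) / 2 := by field_simp
      nlinarith
    · have hy' : 0 < ‖y‖ := lt_of_le_of_ne (τ.norm_nonneg' y) (Ne.symm hy0)
      have := key (‖y‖ / ‖x‖) (by positivity)
      refine le_of_sq_le_sq ?_ (by positivity)
      refine this.trans (le_of_eq ?_)
      field_simp
      ring

theorem norm_smul_le' (c : ℂ) (x : τ.PreL2) : ‖c • x‖ ≤ ‖c‖ * ‖x‖ := by
  rw [τ.norm_le_iff (mul_nonneg (_root_.norm_nonneg _) (τ.norm_nonneg' _)), mul_pow,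
    ENNReal.ofReal_mul (by positivity), ofReal_norm_sq, map_smul]
  rw [← τ.map_real_smul _ (by positivity) (star_mul_self_nonneg _)]
  refine τ.mono (star_mul_self_nonneg _) (le_of_eq ?_)
  rw [star_smul, smul_mul_smul_comm, ← Complex.coe_smul]
  congr 1
  rw [Complex.star_def, ← Complex.normSq_eq_conj_mul_self, Complex.normSq_eq_norm_sq]

instance : NormedAddCommGroup τ.PreL2 :=
  AddGroupNorm.toNormedAddCommGroup
    { toFun := fun x => ‖x‖
      map_zero' := by
        change √_ = 0
        simp [τ.map_zero]
      add_le' := τ.norm_add_le'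
      neg' := fun x => by
        change √_ = √_
        rw [map_neg, star_neg, neg_mul_neg]
      eq_zero_of_map_eq_zero' := fun x hx => by
        have h1 : ‖x‖ ^ 2 = 0 := by
          change ‖x‖ = 0 at hx
          rw [hx]; norm_num
        have h2 := τ.ofReal_norm_sq x
        rw [h1, ENNReal.ofReal_zero] at h2
        have h3 := τ.faithful' _ (star_mul_self_nonneg _) h2.symm
        exact τ.val_inj (by simpa using h3) }

instance : NormedSpace ℂ τ.PreL2 where
  norm_smul_le := τ.norm_smul_le'

/-- The inner product of `𝔫`, antilinear in the first variable, determined by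
`⟪a, a⟫ = ‖a‖ ^ 2 = τ(a* a)`. -/
instance : InnerProductSpace ℂ τ.PreL2 := InnerProductSpace.ofNorm ℂ (by
  intro x y
  have h := congrArg ENNReal.toReal (τ.parallelogram (τ.val x) (τ.val y))
  simp only [← map_add, ← map_sub, ← ofReal_norm_sq] at h
  rw [ENNReal.toReal_add (by simp) (by simp), ENNReal.toReal_add (by finiteness) (by finiteness)] at h
  simp only [ENNReal.toReal_mul, ENNReal.toReal_ofReal (sq_nonneg _), ENNReal.toReal_ofNat] at h
  linarith)

/-- The Hilbert space `L²(τ)`: the completion of `𝔫`. -/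
abbrev L2 : Type _ := UniformSpace.Completion τ.PreL2

end NFSTrace

end

noncomputable section

open scoped ENNReal NNReal Topology ComplexConjugate InnerProductSpace CStarAlgebra TensorProduct
open Filter

namespace NFSTrace

variable {N : Type*} [CStarAlgebra N] [PartialOrder N] [StarOrderedRing N]
  {X : Type*} [NormedAddCommGroup X] [NormedSpace ℂ X] {pre : StrongDual ℂ X ≃ₗᵢ[ℂ] N}
  (τ : NFSTrace N pre)

theorem lowerSemicont {a : N} (ha : 0 ≤ a) (u : ℕ → N) (hu : ∀ k, 0 ≤ u k)
    (hlim : Tendsto u atTop (𝓝 a)) {y : ℝ≥0∞} (hy : y < τ a) : ∀ᶠ k in atTop, y < τ (u k) := by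
  let g : N → WeakDual ℂ X := fun b => StrongDual.toWeakDual (pre.symm b)
  have hg : ∀ b, pre (WeakDual.toStrongDual (g b)) = b := fun b => pre.apply_symm_apply b
  have hgc : Continuous g :=
    NormedSpace.Dual.toWeakDual_continuous.comp pre.symm.continuous
  have h1 := τ.normal' (g a) (by simpa [hg] using ha) y (by simpa [hg] using hy)
  have h2 : Tendsto (fun k => g (u k)) atTop
      (𝓝[{φ : WeakDual ℂ X | 0 ≤ pre (WeakDual.toStrongDual φ)}] (g a)) :=
    tendsto_nhdsWithin_iff.2 ⟨(hgc.tendsto a).comp hlim, Eventually.of_forall fun k => by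
      simpa [hg] using hu k⟩
  filter_upwards [h2.eventually h1] with k hk
  simpa [hg] using hk

theorem exists_trace_approx {a : N} (ha : 0 ≤ a) (hn : a ∈ τ.sqInt) {δ : ℝ≥0∞} (hδ : 0 < δ) :
    ∃ b : N, 0 ≤ b ∧ τ b < ∞ ∧ b ∈ τ.sqInt ∧ τ (star (a - b) * (a - b)) < δ := by
  have hsa : IsSelfAdjoint a := .of_nonneg ha
  have hspec : ∀ s ∈ spectrum ℝ a, 0 ≤ s := fun s hs => spectrum_nonneg_of_nonneg ha hs
  let f : ℝ → ℝ → ℝ := fun e s => max (s - e) 0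
  have hf : ∀ e, Continuous (f e) := fun e => by fun_prop
  let b : ℝ → N := fun e => cfc (f e) a
  have hb0 : ∀ e, 0 ≤ b e := fun e => cfc_nonneg fun s _ => le_max_right _ _
  have hid : a = cfc (fun s : ℝ => s) a := (cfc_id' ℝ a).symm
  have hsub : ∀ e, a - b e = cfc (fun s => s - f e s) a := fun e => by
    rw [cfc_sub (fun s : ℝ => s) (f e) a (by fun_prop) (hf e).continuousOn, ← hid]
  have hbsa : ∀ e, star (b e) = b e := fun e => (IsSelfAdjoint.of_nonneg (hb0 e)).star_eq
  have hsq : a * a = cfc (fun s : ℝ => s * s) a := by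
    rw [cfc_mul (fun s : ℝ => s) (fun s => s) a, ← hid]
  have hle : ∀ e, 0 ≤ e → b e * b e + (a - b e) * (a - b e) ≤ a * a := fun e he => by
    rw [hsub, hsq, ← cfc_mul _ _ a (hf e).continuousOn (hf e).continuousOn,
      ← cfc_mul _ _ a (by fun_prop) (by fun_prop), ← cfc_add (a := a) (f := fun s => f e s * f e s)
        (g := fun s => (s - f e s) * (s - f e s)) (by fun_prop) (by fun_prop)]
    refine cfc_mono (fun s hs => ?_) (by fun_prop) (by fun_prop)
    have h0 := hspec s hs
    have h1 : 0 ≤ f e s := le_max_right _ _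
    have h2 : f e s ≤ s := max_le (by linarith) h0
    nlinarith
  have hle2 : ∀ e, 0 < e → b e ≤ (e⁻¹ : ℝ) • (a * a) := fun e he => by
    rw [hsq, ← cfc_const_mul _ _ a (by fun_prop)]
    refine cfc_mono (fun s hs => ?_) (by fun_prop) (by fun_prop)
    have h0 := hspec s hs
    refine max_le ?_ (by positivity)
    rw [← div_eq_inv_mul, le_div_iff₀ he]
    nlinarith [sq_nonneg (s - e), sq_nonneg e]
  have hpos : ∀ c : N, IsSelfAdjoint c → 0 ≤ c * c := fun c hc => by
    have := star_mul_self_nonneg c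
    rwa [hc.star_eq] at this
  have hbsa' : ∀ e, IsSelfAdjoint (b e) := fun e => .of_nonneg (hb0 e)
  have hnn : τ (a * a) < ∞ := by
    have := τ.mem_sqInt.1 hn; rwa [hsa.star_eq] at this
  have hadd : ∀ e, 0 ≤ e → τ (b e * b e) + τ ((a - b e) * (a - b e)) ≤ τ (a * a) :=
    fun e he => by
      rw [← τ.map_add' _ _ (hpos _ (hbsa' e)) (hpos _ (hsa.sub (hbsa' e)))]
      exact τ.mono (add_nonneg (hpos _ (hbsa' e)) (hpos _ (hsa.sub (hbsa' e)))) (hle e he)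
  have hconv : Tendsto (fun k : ℕ => b (1 / ((k : ℝ) + 1))) atTop (𝓝 a) := by
    rw [tendsto_iff_norm_sub_tendsto_zero]
    refine squeeze_zero (fun _ => norm_nonneg _) (fun k => ?_)
      (tendsto_one_div_add_atTop_nhds_zero_nat (𝕜 := ℝ))
    have he : (0 : ℝ) < 1 / ((k : ℝ) + 1) := by positivity
    rw [norm_sub_rev, hsub]
    refine norm_cfc_le he.le fun s hs => ?_
    have h0 := hspec s hs
    rw [Real.norm_eq_abs, abs_le]
    constructor
    · have : f (1 / ((k : ℝ) + 1)) s ≤ s := max_le (by linarith) h0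
      linarith
    · have : s - 1 / ((k : ℝ) + 1) ≤ f (1 / ((k : ℝ) + 1)) s := le_max_left _ _
      linarith
  have hex : ∃ k : ℕ, τ ((a - b (1 / ((k : ℝ) + 1))) * (a - b (1 / ((k : ℝ) + 1)))) < δ := by
    by_cases h0 : τ (a * a) = 0
    · refine ⟨0, lt_of_le_of_lt (le_trans ?_ (hadd (1 / (((0 : ℕ) : ℝ) + 1)) (by positivity))) ?_⟩
      · exact le_add_self
      · rw [h0]; exact hδ
    · have hlim2 : Tendsto (fun k : ℕ => b (1 / ((k : ℝ) + 1)) * b (1 / ((k : ℝ) + 1))) atTop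
          (𝓝 (a * a)) := hconv.mul hconv
      obtain ⟨k, hk⟩ := (τ.lowerSemicont (hpos a hsa) _ (fun k => hpos _ (hbsa' _)) hlim2
        (ENNReal.sub_lt_self hnn.ne h0 hδ.ne')).exists
      refine ⟨k, ?_⟩
      have h1 := hadd (1 / ((k : ℝ) + 1)) (by positivity)
      by_contra! hc
      have hδt : δ ≠ ∞ := ne_of_lt (hc.trans_lt ((le_add_self.trans h1).trans_lt hnn))
      exact absurd hk (not_lt.2 (ENNReal.le_sub_of_add_le_right hδt (le_trans (by gcongr) h1)))
  obtain ⟨k, hk⟩ := hex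
  set e := 1 / ((k : ℝ) + 1) with he
  have he0 : 0 < e := by positivity
  refine ⟨b e, hb0 e, ?_, ?_, ?_⟩
  · refine (τ.mono (hb0 e) (hle2 e he0)).trans_lt ?_
    rw [τ.map_real_smul _ (by positivity) (hpos a hsa)]
    exact ENNReal.mul_lt_top ENNReal.ofReal_lt_top hnn
  · rw [τ.mem_sqInt, hbsa]
    exact (le_self_add.trans (hadd e he0.le)).trans_lt hnn
  · rwa [(hsa.sub (hbsa' e)).star_eq]

/-! Multiplication operators and the involution on `𝔫`. -/

/-- Left multiplication by `x : N` on `𝔫`. -/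
def lmul (x : N) : τ.PreL2 →ₗ[ℂ] τ.PreL2 where
  toFun a := τ.ofN (x * τ.val a) (τ.mul_mem_left x (τ.val_mem a))
  map_add' a b := τ.val_inj (by simp [mul_add])
  map_smul' c a := τ.val_inj (by simp)

/-- Right multiplication by `x : N` on `𝔫`. -/
def rmul (x : N) : τ.PreL2 →ₗ[ℂ] τ.PreL2 where
  toFun a := τ.ofN (τ.val a * x) (τ.mul_mem_right (τ.val_mem a) x)
  map_add' a b := τ.val_inj (by simp [add_mul])
  map_smul' c a := τ.val_inj (by simp)

/-- The involution on `𝔫`. -/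
def st (a : τ.PreL2) : τ.PreL2 := τ.ofN (star (τ.val a)) (τ.star_mem (τ.val_mem a))

@[simp] theorem val_lmul (x : N) (a : τ.PreL2) : τ.val (τ.lmul x a) = x * τ.val a := rfl
@[simp] theorem val_rmul (x : N) (a : τ.PreL2) : τ.val (τ.rmul x a) = τ.val a * x := rfl
@[simp] theorem val_st (a : τ.PreL2) : τ.val (τ.st a) = star (τ.val a) := rfl

theorem norm_lmul_le (x : N) (a : τ.PreL2) : ‖τ.lmul x a‖ ≤ ‖x‖ * ‖a‖ := by
  rw [τ.norm_le_iff (by positivity), mul_pow, ENNReal.ofReal_mul (by positivity), ofReal_norm_sq]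
  exact τ.le_mul_left _ _

theorem norm_rmul_le (x : N) (a : τ.PreL2) : ‖τ.rmul x a‖ ≤ ‖x‖ * ‖a‖ := by
  rw [τ.norm_le_iff (by positivity), mul_pow, ENNReal.ofReal_mul (by positivity), ofReal_norm_sq]
  exact τ.le_mul_right _ _

theorem norm_eq_of {a b : τ.PreL2}
    (h : τ (star (τ.val a) * τ.val a) = τ (star (τ.val b) * τ.val b)) : ‖a‖ = ‖b‖ := by
  change √_ = √_
  rw [h]

theorem norm_st (a : τ.PreL2) : ‖τ.st a‖ = ‖a‖ := τ.norm_eq_of (by simpa using (τ.star_eq _))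

theorem re_inner_eq (x y : τ.PreL2) :
    (⟪x, y⟫_ℂ).re = (‖x + y‖ ^ 2 - ‖x‖ ^ 2 - ‖y‖ ^ 2) / 2 := by
  have := norm_add_sq (𝕜 := ℂ) x y
  simp only [RCLike.re_to_complex] at this
  linarith

theorem inner_st (x y : τ.PreL2) : ⟪τ.st x, τ.st y⟫_ℂ = ⟪y, x⟫_ℂ := by
  have hre : ∀ x y, (⟪τ.st x, τ.st y⟫_ℂ).re = (⟪x, y⟫_ℂ).re := fun x y => by
    rw [re_inner_eq, re_inner_eq, norm_st, norm_st, ← norm_st τ (x + y)]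
    congr 5
    exact τ.val_inj (by simp)
  have him : (⟪τ.st x, τ.st y⟫_ℂ).im = -(⟪x, y⟫_ℂ).im := by
    have h := hre (Complex.I • x) y
    have e : τ.st (Complex.I • x) = -(Complex.I • τ.st x) := τ.val_inj (by simp)
    rw [e, inner_neg_left, inner_smul_left, inner_smul_left] at h
    simp at h
    linarith
  have h := inner_conj_symm (𝕜 := ℂ) y x
  apply Complex.ext
  · rw [hre, ← h]; exact (Complex.conj_re _).symm.trans (by simp)
  · rw [him, ← h]; exact (Complex.conj_im _).symm

theorem inner_lmul (x : N) (a b : τ.PreL2) :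
    ⟪τ.lmul x a, b⟫_ℂ = ⟪a, τ.lmul (star x) b⟫_ℂ := by
  have hx : x ∈ Submodule.span ℂ (unitary N : Set N) := by
    rw [CStarAlgebra.span_unitary]; trivial
  induction hx using Submodule.span_induction with
  | mem u hu =>
    have hn : ∀ c, ‖τ.lmul u c‖ = ‖c‖ := fun c => τ.norm_eq_of (by
      simp only [val_lmul, star_mul]
      rw [mul_assoc, ← mul_assoc (star u), Unitary.star_mul_self_of_mem hu, one_mul])
    have h := LinearIsometry.inner_map_map ⟨τ.lmul u, hn⟩ a (τ.lmul (star u) b)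
    simp only [LinearIsometry.coe_mk] at h
    rw [← h]
    congr 1
    exact τ.val_inj (by
      simp only [val_lmul]
      rw [← mul_assoc, Unitary.mul_star_self_of_mem hu, one_mul])
  | zero =>
    have e1 : τ.lmul 0 a = 0 := τ.val_inj (by simp)
    have e2 : τ.lmul (star 0) b = 0 := τ.val_inj (by simp)
    rw [e1, e2]; simp
  | add x y _ _ h1 h2 =>
    have e1 : τ.lmul (x + y) a = τ.lmul x a + τ.lmul y a := τ.val_inj (by simp [add_mul])
    have e2 : τ.lmul (star (x + y)) b = τ.lmul (star x) b + τ.lmul (star y) b :=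
      τ.val_inj (by simp [add_mul])
    rw [e1, e2, inner_add_left, inner_add_right, h1, h2]
  | smul c x _ h =>
    have e1 : τ.lmul (c • x) a = c • τ.lmul x a := τ.val_inj (by simp)
    have e2 : τ.lmul (star (c • x)) b = star c • τ.lmul (star x) b := τ.val_inj (by simp)
    rw [e1, e2, inner_smul_left, inner_smul_right, h]; rfl

theorem inner_rmul (x : N) (a b : τ.PreL2) :
    ⟪τ.rmul x a, b⟫_ℂ = ⟪a, τ.rmul (star x) b⟫_ℂ := by
  have e1 : τ.st (τ.rmul x a) = τ.lmul (star x) (τ.st a) := τ.val_inj (by simp)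
  have e2 : τ.st (τ.rmul (star x) b) = τ.lmul x (τ.st b) := τ.val_inj (by simp)
  calc ⟪τ.rmul x a, b⟫_ℂ = ⟪τ.st b, τ.lmul (star x) (τ.st a)⟫_ℂ := by rw [← inner_st, e1]
    _ = ⟪τ.lmul x (τ.st b), τ.st a⟫_ℂ := by rw [inner_lmul]
    _ = ⟪a, τ.rmul (star x) b⟫_ℂ := by rw [← e2, inner_st]

theorem inner_of_trace {a : N} (ha : 0 ≤ a) (hτ : τ a < ∞) (hn : a ∈ τ.sqInt)
    {c : N} (hc : 0 ≤ c) (hcn : c ∈ τ.sqInt) :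
    ⟪τ.ofN a hn, τ.ofN c hcn⟫_ℂ = ((τ (CFC.sqrt a * c * CFC.sqrt a)).toReal : ℂ) := by
  set s := CFC.sqrt a with hs
  set r := CFC.sqrt c with hr
  have hss : star s = s := (IsSelfAdjoint.of_nonneg (CFC.sqrt_nonneg a)).star_eq
  have hrs : star r = r := (IsSelfAdjoint.of_nonneg (CFC.sqrt_nonneg c)).star_eq
  have hs2 : s * s = a := CFC.sqrt_mul_sqrt_self a
  have hr2 : r * r = c := CFC.sqrt_mul_sqrt_self c
  have hsn : s ∈ τ.sqInt := by rw [mem_sqInt, hss, hs2]; exact hτ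
  set S := τ.ofN s hsn
  have e1 : τ.ofN a hn = τ.lmul s S := τ.val_inj (by simp [S, hs2])
  have e3 : τ.lmul (star s) (τ.ofN c hcn) = τ.st (τ.lmul c S) := τ.val_inj (by
    have : star c = c := (IsSelfAdjoint.of_nonneg hc).star_eq
    simp [S, hss, this])
  have e4 : S = τ.st S := τ.val_inj (by simp [S, hss])
  have e5 : τ.lmul c S = τ.lmul (star r) (τ.lmul r S) := τ.val_inj (by
    simp [S, hrs, ← mul_assoc, hr2])
  rw [e1, inner_lmul, e3]
  nth_rewrite 1 [e4]
  rw [inner_st, e5, inner_lmul, star_star, inner_self_eq_norm_sq_to_K]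
  have h := τ.norm_sq (τ.lmul r S)
  have e6 : star (τ.val (τ.lmul r S)) * τ.val (τ.lmul r S) = s * c * s := by
    simp only [val_lmul, S, val_ofN, star_mul, hss, hrs]
    rw [← hr2]; simp only [mul_assoc]
  rw [e6] at h
  rw [← h]
  exact (Complex.ofReal_pow _ _).symm

end NFSTrace
end

noncomputable section

open scoped ENNReal NNReal Topology ComplexConjugate InnerProductSpace CStarAlgebra TensorProduct
open Filter

theorem exists_eq_star_mul_self {A : Type*} [NonUnitalCStarAlgebra A] [PartialOrder A]
    [StarOrderedRing A] {a : A} (h : 0 ≤ a) : ∃ b, a = star b * b :=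
  CStarAlgebra.nonneg_iff_eq_star_mul_self.1 h

/-- For a completely positive map `φ`, the matrix `φ(y_p* y_q)` is of the form `C* C`. -/
theorem exists_cp_factor {N : Type*} [CStarAlgebra N] [PartialOrder N] [StarOrderedRing N]
    {ι : Type*} [Fintype ι] (φ : N →CP N) (y : ι → N) :
    ∃ C : ι → ι → N, ∀ p q, φ (star (y p) * y q) = ∑ r, star (C r p) * C r q := by
  classical
  rcases isEmpty_or_nonempty ι with h | ⟨⟨r0⟩⟩
  · exact ⟨fun _ _ => 0, fun p => h.elim p⟩
  let Y : CStarMatrix ι ι N := CStarMatrix.ofMatrix fun r p => if r = r0 then y p else 0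
  have h0 : 0 ≤ star Y * Y := star_mul_self_nonneg Y
  have h1 := φ.map_cstarMatrix_nonneg _ h0
  obtain ⟨C, hC⟩ := exists_eq_star_mul_self h1
  refine ⟨C, fun p q => ?_⟩
  have h2 := congrFun (congrFun hC p) q
  rw [CStarMatrix.map_apply] at h2
  have h3 : (star Y * Y) p q = star (y p) * y q := by
    have e : (star Y * Y) p q = ∑ r, star (if r = r0 then y p else 0) *
        (if r = r0 then y q else 0) := by
      rw [CStarMatrix.mul_apply]; rfl
    rw [e, Finset.sum_eq_single r0]
    · simp
    · intro r _ hr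
      simp [hr]
    · simp
  rw [h3] at h2
  exact h2.trans (by rw [CStarMatrix.mul_apply]; rfl)

theorem cp_sum_nonneg {N : Type*} [CStarAlgebra N] [PartialOrder N] [StarOrderedRing N]
    {ι : Type*} [Fintype ι] (φ : N →CP N) (y z : ι → N) :
    0 ≤ ∑ p, ∑ q, star (z p) * φ (star (y p) * y q) * z q := by
  obtain ⟨C, hC⟩ := exists_cp_factor φ y
  have : ∑ p, ∑ q, star (z p) * φ (star (y p) * y q) * z q =
      ∑ r, star (∑ p, C r p * z p) * ∑ q, C r q * z q := by
    simp only [hC, star_sum, star_mul, Finset.sum_mul, Finset.mul_sum, mul_assoc]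
    calc _ = ∑ p, ∑ r, ∑ q, star (z p) * (star (C r p) * (C r q * z q)) :=
          Finset.sum_congr rfl fun p _ => Finset.sum_comm
      _ = ∑ r, ∑ p, ∑ q, star (z p) * (star (C r p) * (C r q * z q)) := Finset.sum_comm
      _ = _ := Finset.sum_congr rfl fun r _ => Finset.sum_comm
  rw [this]
  exact Finset.sum_nonneg fun r _ => star_mul_self_nonneg _

theorem cp_map_star {N : Type*} [CStarAlgebra N] [PartialOrder N] [StarOrderedRing N]
    (φ : N →CP N) (a : N) : φ (star a) = star (φ a) := by
  obtain ⟨C, hC⟩ := exists_cp_factor φ ![a, 1]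
  have h1 := hC 0 1
  have h2 := hC 1 0
  simp only [Matrix.cons_val_zero, Matrix.cons_val_one, mul_one, star_one, one_mul] at h1 h2
  rw [h1, h2]
  simp

/-- A Markov semigroup on the W*-algebra `N` with predual `X`. -/
structure MarkovSemigroup (N : Type*) [CStarAlgebra N] [PartialOrder N] [StarOrderedRing N]
    {X : Type*} [NormedAddCommGroup X] [NormedSpace ℂ X]
    (pre : StrongDual ℂ X ≃ₗᵢ[ℂ] N) where
  toFun : ℝ≥0 → (N →CP N)
  norm_le' : ∀ t a, ‖toFun t a‖ ≤ ‖a‖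
  map_one' : ∀ t, toFun t 1 = 1
  zero' : ∀ a, toFun 0 a = a
  add' : ∀ s t a, toFun (s + t) a = toFun s (toFun t a)
  /-- elementwise weak-* continuity at `0` -/
  continuous' : ∀ (a : N) (x : X),
    Tendsto (fun t => pre.symm (toFun t a) x) (𝓝 0) (𝓝 (pre.symm a x))

namespace MarkovSemigroup

variable {N : Type*} [CStarAlgebra N] [PartialOrder N] [StarOrderedRing N]
  {X : Type*} [NormedAddCommGroup X] [NormedSpace ℂ X] {pre : StrongDual ℂ X ≃ₗᵢ[ℂ] N}

instance : CoeFun (MarkovSemigroup N pre) (fun _ => ℝ≥0 → (N →CP N)) := ⟨MarkovSemigroup.toFun⟩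

/-- The trace `τ` is symmetric with respect to the semigroup: `τ(a P_t(b)) = τ(P_t(a) b)` for
positive `a`, `b`, where `τ(x y)` for positive `x`, `y` stands for `τ(x^(1/2) y x^(1/2))`, which
equals `τ(y^(1/2) x y^(1/2))`. -/
def IsSymmetric (P : MarkovSemigroup N pre) (τ : NFSTrace N pre) : Prop :=
  ∀ (t : ℝ≥0) (a b : N), 0 ≤ a → 0 ≤ b →
    τ (CFC.sqrt a * P t b * CFC.sqrt a) = τ (CFC.sqrt b * P t a * CFC.sqrt b)

end MarkovSemigroup

/-- A W*-algebra `N` (with predual `X`) with a normal faithful semi-finite trace and a Markov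
semigroup for which the trace is symmetric. -/
structure DirichletSpace (N : Type*) [CStarAlgebra N] [PartialOrder N] [StarOrderedRing N]
    (X : Type*) [NormedAddCommGroup X] [NormedSpace ℂ X] where
  pre : StrongDual ℂ X ≃ₗᵢ[ℂ] N
  τ : NFSTrace N pre
  P : MarkovSemigroup N pre
  symm : P.IsSymmetric τ

namespace DirichletSpace

variable {N : Type*} [CStarAlgebra N] [PartialOrder N] [StarOrderedRing N]
  {X : Type*} [NormedAddCommGroup X] [NormedSpace ℂ X] (D : DirichletSpace N X)

theorem P_nonneg (t : ℝ≥0) {a : N} (ha : 0 ≤ a) : 0 ≤ D.P t a := map_nonneg (D.P t) ha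

theorem trace_P (t : ℝ≥0) {a : N} (ha : 0 ≤ a) : D.τ (D.P t a) = D.τ a := by
  have h := D.symm t 1 a zero_le_one ha
  rw [D.P.map_one', CFC.sqrt_one, one_mul, mul_one, mul_one, CFC.sqrt_mul_sqrt_self a] at h
  exact h

theorem schwarz (t : ℝ≥0) (a : N) : star (D.P t a) * D.P t a ≤ D.P t (star a * a) := by
  have h := cp_sum_nonneg (D.P t) ![a, 1] ![1, -D.P t a]
  simp only [Fin.sum_univ_two, Matrix.cons_val_zero, Matrix.cons_val_one, star_one, mul_one,
    one_mul, D.P.map_one', cp_map_star, star_neg] at h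
  rw [← sub_nonneg]
  convert h using 1
  noncomm_ring

theorem P_mem (t : ℝ≥0) {a : N} (ha : a ∈ D.τ.sqInt) : D.P t a ∈ D.τ.sqInt := by
  rw [D.τ.mem_sqInt]
  refine (D.τ.mono (star_mul_self_nonneg _) (D.schwarz t a)).trans_lt ?_
  rw [D.trace_P t (star_mul_self_nonneg _)]
  exact ha

/-- The restriction of `P_t` to `𝔫`, a contraction for the norm of `L²(τ)`. -/
def opPre (t : ℝ≥0) : D.τ.PreL2 →L[ℂ] D.τ.PreL2 :=
  LinearMap.mkContinuous
    { toFun := fun a => D.τ.ofN (D.P t (D.τ.val a)) (D.P_mem t (D.τ.val_mem a))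
      map_add' := fun a b => D.τ.val_inj (by simp)
      map_smul' := fun c a => D.τ.val_inj (by simp) } 1 (fun a => by
    rw [one_mul, D.τ.norm_le_iff (norm_nonneg _), D.τ.ofReal_norm_sq]
    refine (D.τ.mono (star_mul_self_nonneg _) (D.schwarz t _)).trans ?_
    rw [D.trace_P t (star_mul_self_nonneg _)])

@[simp] theorem val_opPre (t : ℝ≥0) (a : D.τ.PreL2) :
    D.τ.val (D.opPre t a) = D.P t (D.τ.val a) := rfl

/-- The operator `P_t^(2)` on `L²(τ)`: the continuous extension of `P_t`. -/
def op (t : ℝ≥0) : D.τ.L2 →L[ℂ] D.τ.L2 := (D.opPre t).completion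

theorem op_coe (t : ℝ≥0) (a : D.τ.PreL2) : D.op t (a : D.τ.L2) = (D.opPre t a : D.τ.L2) :=
  (D.opPre t).completion_apply_coe a

theorem norm_opPre_le (t : ℝ≥0) (a : D.τ.PreL2) : ‖D.opPre t a‖ ≤ ‖a‖ := by
  have := (D.opPre t).le_of_opNorm_le (LinearMap.mkContinuous_norm_le _ zero_le_one _) a
  simpa using this

theorem norm_op_le (t : ℝ≥0) (f : D.τ.L2) : ‖D.op t f‖ ≤ ‖f‖ := by
  induction f using UniformSpace.Completion.induction_on with
  | hp => exact isClosed_le (by fun_prop) (by fun_prop)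
  | ih a => rw [op_coe, UniformSpace.Completion.norm_coe, UniformSpace.Completion.norm_coe]
            exact D.norm_opPre_le t a

/-- The closure under `ℂ`-span of positive elements with finite trace is dense in `𝔫`. -/
theorem induction_posTrace (p : D.τ.PreL2 → Prop) (hclosed : IsClosed {a | p a})
    (hadd : ∀ a b, p a → p b → p (a + b)) (hsmul : ∀ (c : ℂ) a, p a → p (c • a))
    (hpos : ∀ a : D.τ.PreL2, 0 ≤ D.τ.val a → D.τ (D.τ.val a) < ∞ → p a) (a : D.τ.PreL2) : p a := by
  have h1 : ∀ a : D.τ.PreL2, 0 ≤ D.τ.val a → p a := by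
    intro a ha
    have : a ∈ closure {a | p a} := by
      rw [Metric.mem_closure_iff]
      intro ε hε
      obtain ⟨b, hb0, hbt, hbn, hb⟩ := D.τ.exists_trace_approx ha (D.τ.val_mem a)
        (δ := ENNReal.ofReal (ε ^ 2)) (by positivity)
      refine ⟨D.τ.ofN b hbn, hpos _ hb0 hbt, ?_⟩
      rw [dist_eq_norm]
      have h2 := D.τ.ofReal_norm_sq (a - D.τ.ofN b hbn)
      rw [map_sub, NFSTrace.val_ofN] at h2
      rw [← h2, ENNReal.ofReal_lt_ofReal_iff (by positivity)] at hb
      exact lt_of_pow_lt_pow_left₀ 2 hε.le hb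
    rwa [hclosed.closure_eq] at this
  have h2 : ∀ a : D.τ.PreL2, IsSelfAdjoint (D.τ.val a) → p a := by
    intro a ha
    set b := D.τ.val a with hb
    have hdec : b⁺ - b⁻ = b := CFC.posPart_sub_negPart b ha
    have hpp : star b⁺ = b⁺ := (IsSelfAdjoint.of_nonneg (CFC.posPart_nonneg b)).star_eq
    have hnn : star b⁻ = b⁻ := (IsSelfAdjoint.of_nonneg (CFC.negPart_nonneg b)).star_eq
    have hsq : star b * b = star b⁺ * b⁺ + star b⁻ * b⁻ := by
      rw [ha.star_eq, hpp, hnn]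
      nth_rewrite 1 2 [← hdec]
      rw [sub_mul, mul_sub, mul_sub, CFC.posPart_mul_negPart, CFC.negPart_mul_posPart]
      abel
    have hfin : D.τ (star b⁺ * b⁺) + D.τ (star b⁻ * b⁻) < ∞ := by
      rw [← D.τ.map_add' _ _ (star_mul_self_nonneg _) (star_mul_self_nonneg _), ← hsq]
      exact D.τ.val_mem a
    have hm1 : b⁺ ∈ D.τ.sqInt := le_self_add.trans_lt hfin
    have hm2 : b⁻ ∈ D.τ.sqInt := le_add_self.trans_lt hfin
    have e : a = D.τ.ofN _ hm1 + (-1 : ℂ) • D.τ.ofN _ hm2 := D.τ.val_inj (by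
      simp only [map_add, map_smul, NFSTrace.val_ofN, ← hb]
      rw [neg_smul, one_smul, ← sub_eq_add_neg, hdec])
    rw [e]
    exact hadd _ _ (h1 _ (CFC.posPart_nonneg b)) (hsmul _ _ (h1 _ (CFC.negPart_nonneg b)))
  have e : a = (2⁻¹ : ℂ) • (a + D.τ.st a) +
      (-(Complex.I / 2)) • (Complex.I • (a - D.τ.st a)) := D.τ.val_inj (by
    simp only [map_add, map_smul, map_sub, NFSTrace.val_st, smul_smul]
    have : -(Complex.I / 2) * Complex.I = 2⁻¹ := by
      have := Complex.I_mul_I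
      linear_combination (-1 / 2 : ℂ) * this
    rw [this, ← smul_add]
    rw [show D.τ.val a + star (D.τ.val a) + (D.τ.val a - star (D.τ.val a)) = (2 : ℂ) • D.τ.val a by
      rw [two_smul]; abel]
    rw [smul_smul]; norm_num)
  rw [e]
  refine hadd _ _ (hsmul _ _ (h2 _ ?_)) (hsmul _ _ (h2 _ ?_))
  · simp [isSelfAdjoint_iff, add_comm]
  · simp only [isSelfAdjoint_iff, map_smul, map_sub, NFSTrace.val_st, star_smul, star_sub,
      star_star, Complex.star_def, Complex.conj_I, neg_smul, ← smul_neg, neg_sub]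

theorem opPre_symm (t : ℝ≥0) (a b : D.τ.PreL2) : ⟪D.opPre t a, b⟫_ℂ = ⟪a, D.opPre t b⟫_ℂ := by
  refine D.induction_posTrace (fun a => ⟪D.opPre t a, b⟫_ℂ = ⟪a, D.opPre t b⟫_ℂ)
    (isClosed_eq (by fun_prop) (by fun_prop))
    (fun x y hx hy => by simp only [map_add, inner_add_left, hx, hy])
    (fun c x hx => by simp only [map_smul, inner_smul_left, hx]) ?_ a
  intro a ha hat
  refine D.induction_posTrace (fun b => ⟪D.opPre t a, b⟫_ℂ = ⟪a, D.opPre t b⟫_ℂ)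
    (isClosed_eq (by fun_prop) (by fun_prop))
    (fun x y hx hy => by simp only [map_add, inner_add_right, hx, hy])
    (fun c x hx => by simp only [map_smul, inner_smul_right, hx]) ?_ b
  intro b hb _
  have h1 := D.τ.inner_of_trace ha hat (D.τ.val_mem a) (D.P_nonneg t hb)
    (D.P_mem t (D.τ.val_mem b))
  have h2 := D.τ.inner_of_trace hb ‹_› (D.τ.val_mem b) (D.P_nonneg t ha)
    (D.P_mem t (D.τ.val_mem a))
  rw [D.symm t _ _ ha hb, ← h2] at h1
  have h3 : ⟪D.opPre t a, b⟫_ℂ = ⟪b, D.opPre t a⟫_ℂ := by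
    rw [← inner_conj_symm]
    change (starRingEnd ℂ) ⟪D.τ.ofN _ (D.τ.val_mem b), D.τ.ofN _ (D.P_mem t (D.τ.val_mem a))⟫_ℂ =
      ⟪D.τ.ofN _ (D.τ.val_mem b), D.τ.ofN _ (D.P_mem t (D.τ.val_mem a))⟫_ℂ
    rw [h2, Complex.conj_ofReal]
  rw [h3]
  exact h1.symm

end DirichletSpace

end

noncomputable section

open scoped ENNReal NNReal Topology ComplexConjugate InnerProductSpace CStarAlgebra TensorProduct
open Filter

namespace DirichletSpace

variable {N : Type*} [CStarAlgebra N] [PartialOrder N] [StarOrderedRing N]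
  {X : Type*} [NormedAddCommGroup X] [NormedSpace ℂ X] (D : DirichletSpace N X)

/-- The approximating quadratic form `t⁻¹ ⟪f, f - P_t f⟫`. -/
def energyAt (t : ℝ≥0) (f : D.τ.L2) : ℝ := (⟪f, f - D.op t f⟫_ℂ).re / t

/-- The quadratic form `ℰ[f] = sup_{t > 0} t⁻¹ ⟪f, f - P_t f⟫ = lim_{t → 0} t⁻¹ ⟪f, f - P_t f⟫`
of the semigroup on `L²(τ)`, with values in `[0, ∞]`. -/
def energy (f : D.τ.L2) : ℝ≥0∞ := ⨆ (t : ℝ≥0) (_ : 0 < t), ENNReal.ofReal (D.energyAt t f)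

/-- The Dirichlet form `ℰ(f, g)`, antilinear in `f`, obtained from `ℰ[·]` by polarization. -/
def form (f g : D.τ.L2) : ℂ :=
  (((D.energy (f + g)).toReal : ℂ) - (D.energy (f - g)).toReal
    - Complex.I * (D.energy (f + Complex.I • g)).toReal
    + Complex.I * (D.energy (f - Complex.I • g)).toReal) / 4

theorem op_symm (t : ℝ≥0) (f g : D.τ.L2) : ⟪D.op t f, g⟫_ℂ = ⟪f, D.op t g⟫_ℂ := by
  induction f, g using UniformSpace.Completion.induction_on₂ with
  | hp => exact isClosed_eq (by fun_prop) (by fun_prop)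
  | ih a b =>
    rw [op_coe, op_coe, UniformSpace.Completion.inner_coe, UniformSpace.Completion.inner_coe]
    exact D.opPre_symm t a b

theorem op_add (s t : ℝ≥0) (f : D.τ.L2) : D.op (s + t) f = D.op s (D.op t f) := by
  induction f using UniformSpace.Completion.induction_on with
  | hp => exact isClosed_eq (by fun_prop) (by fun_prop)
  | ih a =>
    rw [op_coe, op_coe, op_coe]
    congr 1
    exact D.τ.val_inj (D.P.add' s t _)

theorem op_zero (f : D.τ.L2) : D.op 0 f = f := by
  induction f using UniformSpace.Completion.induction_on with
  | hp => exact isClosed_eq (by fun_prop) (by fun_prop)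
  | ih a =>
    rw [op_coe]
    congr 1
    exact D.τ.val_inj (D.P.zero' _)

theorem re_inner_op (t : ℝ≥0) (f : D.τ.L2) :
    (⟪f, D.op t f⟫_ℂ).re = ‖D.op (t / 2) f‖ ^ 2 := by
  rw [← inner_self_eq_norm_sq (𝕜 := ℂ), op_symm, ← op_add, add_halves]; rfl

/-- `‖f‖² - ⟪f, P_t f⟫`. -/
def defect (t : ℝ≥0) (f : D.τ.L2) : ℝ := ‖f‖ ^ 2 - ‖D.op (t / 2) f‖ ^ 2

theorem defect_eq (t : ℝ≥0) (f : D.τ.L2) : D.defect t f = (⟪f, f - D.op t f⟫_ℂ).re := by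
  rw [defect, ← re_inner_op, inner_sub_right, Complex.sub_re, ← inner_self_eq_norm_sq (𝕜 := ℂ)]
  rfl

theorem energyAt_eq (t : ℝ≥0) (f : D.τ.L2) : D.energyAt t f = D.defect t f / t := by
  rw [energyAt, defect_eq]

theorem defect_nonneg (t : ℝ≥0) (f : D.τ.L2) : 0 ≤ D.defect t f := by
  have := D.norm_op_le (t / 2) f
  rw [defect, sub_nonneg]; gcongr

theorem energyAt_nonneg (t : ℝ≥0) (f : D.τ.L2) : 0 ≤ D.energyAt t f := by
  rw [energyAt_eq]; exact div_nonneg (D.defect_nonneg t f) t.2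

theorem defect_mono {s t : ℝ≥0} (h : s ≤ t) (f : D.τ.L2) : D.defect s f ≤ D.defect t f := by
  obtain ⟨r, rfl⟩ := exists_add_of_le h
  have h1 : D.op ((s + r) / 2) f = D.op (r / 2) (D.op (s / 2) f) := by
    rw [← op_add, ← add_div, add_comm r s]
  have h2 := D.norm_op_le (r / 2) (D.op (s / 2) f)
  rw [defect, defect, h1]
  gcongr

theorem defect_second (s u : ℝ≥0) (f : D.τ.L2) :
    D.defect (s + u + u) f - D.defect (s + u) f ≤ D.defect (s + u) f - D.defect s f := by
  set g := D.op (s / 2) f with hg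
  have e1 : D.op ((s + u + u) / 2) f = D.op u g := by
    have : (s + u + u) / 2 = u + s / 2 := by apply NNReal.eq; push_cast; ring
    rw [hg, ← op_add, this]
  have e2 : ‖D.op ((s + u) / 2) f‖ ^ 2 = (⟪g, D.op u g⟫_ℂ).re := by
    rw [re_inner_op, hg, ← op_add, ← add_div, add_comm u s]
  have h := sq_nonneg ‖g - D.op u g‖
  have h2 := norm_sub_sq (𝕜 := ℂ) g (D.op u g)
  simp only [RCLike.re_to_complex] at h2
  simp only [defect, e1, e2, ← hg]
  linarith

theorem defect_mul (u : ℝ≥0) (f : D.τ.L2) {m n : ℕ} (hmn : m ≤ n) :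
    (m : ℝ) * D.defect (n * u) f ≤ n * D.defect (m * u) f := by
  set d : ℕ → ℝ := fun k => D.defect ((k + 1 : ℕ) * u) f - D.defect (k * u) f with hd
  have hanti : Antitone d := antitone_nat_of_succ_le fun k => by
    have := D.defect_second (k * u) u f
    simp only [hd]
    have e1 : ((k + 1 : ℕ) : ℝ≥0) * u = k * u + u := by push_cast; ring
    have e2 : ((k + 1 + 1 : ℕ) : ℝ≥0) * u = k * u + u + u := by push_cast; ring
    rw [e1, e2]; exact this
  have h0 : D.defect ((0 : ℕ) * u) f = 0 := by simp [defect, op_zero]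
  have hsum : ∀ k : ℕ, D.defect (k * u) f = ∑ i ∈ Finset.range k, d i := fun k => by
    rw [Finset.sum_range_sub (fun k : ℕ => D.defect (k * u) f), h0, sub_zero]
  have hS : (m : ℝ) * d m ≤ D.defect (m * u) f := by
    rw [hsum]
    calc (m : ℝ) * d m = ∑ i ∈ Finset.range m, d m := by simp
      _ ≤ _ := Finset.sum_le_sum fun i hi => hanti (Finset.mem_range.1 hi).le
  obtain ⟨k, rfl⟩ := Nat.exists_eq_add_of_le hmn
  have hT : D.defect ((m + k : ℕ) * u) f ≤ D.defect (m * u) f + k * d m := by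
    rw [hsum, hsum, Finset.sum_range_add]
    gcongr
    calc _ ≤ ∑ i ∈ Finset.range k, d m := Finset.sum_le_sum fun i _ => hanti (Nat.le_add_right m i)
      _ = _ := by simp
  have hm : (0 : ℝ) ≤ m := by positivity
  have hk : (0 : ℝ) ≤ k := by positivity
  push_cast at *
  nlinarith [mul_le_mul_of_nonneg_left hT hm, mul_le_mul_of_nonneg_left hS hk]

theorem energyAt_anti {s t : ℝ≥0} (hs : 0 < s) (h : s ≤ t) (f : D.τ.L2) :
    D.energyAt t f ≤ D.energyAt s f := by
  have ht : 0 < t := hs.trans_le h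
  have hs' : (0 : ℝ) < s := hs
  have ht' : (0 : ℝ) < t := ht
  rw [energyAt_eq, energyAt_eq, div_le_div_iff₀ ht' hs']
  by_contra! hc
  have hpos : 0 < D.defect t f := by
    rcases (D.defect_nonneg t f).lt_or_eq with h0 | h0
    · exact h0
    · rw [← h0, zero_mul] at hc
      exact absurd hc (not_lt.2 (mul_nonneg (D.defect_nonneg s f) ht'.le))
  have hq : D.defect s f / D.defect t f < s / t := by
    rw [div_lt_div_iff₀ hpos ht']; linarith [mul_comm (D.defect t f) (s : ℝ)]
  obtain ⟨q, hq1, hq2⟩ := exists_rat_btwn hq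
  have hq0 : 0 < q := by
    have : (0 : ℝ) < q := lt_of_le_of_lt (div_nonneg (D.defect_nonneg s f) hpos.le) hq1
    exact_mod_cast this
  set m := q.num.toNat
  set n := q.den
  have hn : 0 < n := q.den_pos
  have hn' : (0 : ℝ) < n := by exact_mod_cast hn
  have hqr : (q : ℝ) = m / n := by
    have h1 : ((m : ℤ) : ℝ) = q.num := by
      exact_mod_cast Int.toNat_of_nonneg (Rat.num_nonneg.2 hq0.le)
    rw [← Rat.num_div_den q]
    push_cast
    rw [← h1]
    simp [n]
  have hst : (s : ℝ) / t ≤ 1 := by rw [div_le_one ht']; exact_mod_cast h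
  have hmn : m ≤ n := by
    have : (m : ℝ) / n ≤ 1 := by rw [← hqr]; linarith
    rw [div_le_one hn'] at this
    exact_mod_cast this
  have key := D.defect_mul (t / n) f hmn
  have e1 : (n : ℝ≥0) * (t / n) = t := mul_div_cancel₀ _ (by positivity)
  rw [e1] at key
  have hle : (m : ℝ≥0) * (t / n) ≤ s := by
    rw [← NNReal.coe_le_coe]
    push_cast
    rw [hqr, lt_div_iff₀ ht'] at hq2
    calc (m : ℝ) * (t / n) = m / n * t := by ring
      _ ≤ s := hq2.le
  have h2 := D.defect_mono hle f
  rw [hqr, div_lt_div_iff₀ hpos hn'] at hq1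
  nlinarith

theorem tendsto_energyAt_ofReal (f : D.τ.L2) :
    Tendsto (fun t => ENNReal.ofReal (D.energyAt t f)) (𝓝[>] 0) (𝓝 (D.energy f)) := by
  refine tendsto_order.2 ⟨fun c hc => ?_, fun c hc => ?_⟩
  · obtain ⟨t, ht⟩ := lt_iSup_iff.1 hc
    obtain ⟨ht0, ht⟩ := lt_iSup_iff.1 ht
    filter_upwards [Ioc_mem_nhdsGT ht0] with s hs
    exact ht.trans_le (ENNReal.ofReal_le_ofReal (D.energyAt_anti hs.1 hs.2 f))
  · filter_upwards [self_mem_nhdsWithin] with s hs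
    exact lt_of_le_of_lt (le_iSup₂ (f := fun t (_ : 0 < t) => ENNReal.ofReal (D.energyAt t f)) s hs)
      hc

theorem tendsto_energyAt {f : D.τ.L2} (hf : D.energy f < ∞) :
    Tendsto (fun t => D.energyAt t f) (𝓝[>] 0) (𝓝 (D.energy f).toReal) := by
  have := (ENNReal.tendsto_toReal hf.ne).comp (D.tendsto_energyAt_ofReal f)
  refine this.congr fun t => ?_
  exact ENNReal.toReal_ofReal (D.energyAt_nonneg t f)

theorem energy_lt_top_iff {f : D.τ.L2} :
    D.energy f < ∞ ↔ ∃ C : ℝ, ∀ t : ℝ≥0, 0 < t → D.energyAt t f ≤ C := by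
  constructor
  · intro h
    refine ⟨(D.energy f).toReal, fun t ht => ?_⟩
    have h1 := le_iSup₂ (f := fun t (_ : 0 < t) => ENNReal.ofReal (D.energyAt t f)) t ht
    rw [← ENNReal.toReal_ofReal (D.energyAt_nonneg t f)]
    exact ENNReal.toReal_mono h.ne h1
  · rintro ⟨C, hC⟩
    refine lt_of_le_of_lt (iSup₂_le fun t ht => ENNReal.ofReal_le_ofReal (hC t ht))
      ENNReal.ofReal_lt_top

/-- The approximating sesquilinear form `t⁻¹ ⟪f, g - P_t g⟫`. -/
def formAt (t : ℝ≥0) (f g : D.τ.L2) : ℂ := ⟪f, g - D.op t g⟫_ℂ / t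

theorem energyAt_polar (t : ℝ≥0) (f g : D.τ.L2) (c : ℂ) :
    D.energyAt t (f + c • g) =
      D.energyAt t f + ‖c‖ ^ 2 * D.energyAt t g + 2 * (c * D.formAt t f g).re := by
  have h1 : ⟪g, f - D.op t f⟫_ℂ = (starRingEnd ℂ) ⟪f, g - D.op t g⟫_ℂ := by
    rw [inner_conj_symm, inner_sub_left, inner_sub_right, op_symm]
  have h2 : f + c • g - D.op t (f + c • g) = (f - D.op t f) + c • (g - D.op t g) := by
    simp only [map_add, map_smul, smul_sub]; abel
  have h3 : ⟪f + c • g, f + c • g - D.op t (f + c • g)⟫_ℂ =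
      ⟪f, f - D.op t f⟫_ℂ + (Complex.normSq c : ℂ) * ⟪g, g - D.op t g⟫_ℂ +
      (c * ⟪f, g - D.op t g⟫_ℂ + (starRingEnd ℂ) (c * ⟪f, g - D.op t g⟫_ℂ)) := by
    rw [h2, inner_add_left, inner_add_right, inner_add_right, inner_smul_left, inner_smul_right,
      inner_smul_left, inner_smul_right, h1, map_mul, Complex.normSq_eq_conj_mul_self]
    ring
  have h4 : c * D.formAt t f g = (c * ⟪f, g - D.op t g⟫_ℂ) / ((t : ℝ) : ℂ) := by
    rw [formAt, mul_div_assoc]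
  rw [energyAt, h3, h4, Complex.div_ofReal_re, energyAt, energyAt, Complex.add_re, Complex.add_re,
    Complex.re_ofReal_mul, Complex.add_re, Complex.conj_re, Complex.normSq_eq_norm_sq]
  ring

/-- The domain `D(ℰ) = {f | ℰ[f] < ∞}`. -/
def dom : Submodule ℂ D.τ.L2 where
  carrier := {f | D.energy f < ∞}
  zero_mem' := D.energy_lt_top_iff.2 ⟨0, fun t _ => by simp [energyAt]⟩
  add_mem' := by
    intro f g hf hg
    obtain ⟨C, hC⟩ := D.energy_lt_top_iff.1 hf
    obtain ⟨C', hC'⟩ := D.energy_lt_top_iff.1 hg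
    refine D.energy_lt_top_iff.2 ⟨2 * C + 2 * C', fun t ht => ?_⟩
    have h1 := D.energyAt_polar t f g 1
    have h2 := D.energyAt_polar t f g (-1)
    have h3 := D.energyAt_nonneg t (f + (-1 : ℂ) • g)
    rw [one_smul] at h1
    simp at h1 h2
    have := hC t ht
    have := hC' t ht
    have h4 : D.energyAt t (f + (-1 : ℂ) • g) =
        D.energyAt t f + D.energyAt t g + -(2 * (D.formAt t f g).re) := by
      rw [← h2]; congr 2; simp
    linarith
  smul_mem' := by
    intro c f hf
    obtain ⟨C, hC⟩ := D.energy_lt_top_iff.1 hf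
    refine D.energy_lt_top_iff.2 ⟨‖c‖ ^ 2 * C, fun t ht => ?_⟩
    have h1 := D.energyAt_polar t 0 f c
    simp [formAt, energyAt] at h1
    have h2 := hC t ht
    have h3 : D.energyAt t (c • f) = ‖c‖ ^ 2 * D.energyAt t f := by
      rw [energyAt, energyAt, map_smul]; exact h1
    rw [h3]
    gcongr

theorem tendsto_formAt {f g : D.τ.L2} (hf : f ∈ D.dom) (hg : g ∈ D.dom) :
    Tendsto (fun t => D.formAt t f g) (𝓝[>] 0) (𝓝 (D.form f g)) := by
  have key : ∀ c : ℂ, Tendsto (fun t => ((D.energyAt t (f + c • g) : ℝ) : ℂ)) (𝓝[>] 0)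
      (𝓝 ((D.energy (f + c • g)).toReal : ℂ)) := fun c =>
    (Complex.continuous_ofReal.tendsto _).comp
      (D.tendsto_energyAt (D.dom.add_mem hf (D.dom.smul_mem c hg)))
  have h := ((((key 1).sub (key (-1))).sub ((key Complex.I).const_mul Complex.I)).add
    ((key (-Complex.I)).const_mul Complex.I)).div_const 4
  have e : D.form f g = (((D.energy (f + (1 : ℂ) • g)).toReal : ℂ)
      - (D.energy (f + (-1 : ℂ) • g)).toReal
      - Complex.I * (D.energy (f + Complex.I • g)).toReal
      + Complex.I * (D.energy (f + (-Complex.I) • g)).toReal) / 4 := by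
    rw [form, one_smul, neg_smul, one_smul, neg_smul, ← sub_eq_add_neg, ← sub_eq_add_neg]
  rw [e]
  refine h.congr fun t => ?_
  simp only [energyAt_polar]
  apply Complex.ext
  · simp
    ring
  · simp
    ring

/-- If `g` is in the domain of the generator `Δ` of the semigroup on `L²(τ)`, with `Δ g = h`, then
`g ∈ D(ℰ)` and `ℰ(f, g) = ⟪f, -Δ g⟫` for all `f ∈ D(ℰ)`. -/
theorem form_eq_of_generator {g h : D.τ.L2}
    (hg : Tendsto (fun t : ℝ≥0 => (t : ℂ)⁻¹ • (D.op t g - g)) (𝓝[>] 0) (𝓝 h)) :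
    g ∈ D.dom ∧ ∀ f ∈ D.dom, D.form f g = ⟪f, -h⟫_ℂ := by
  have key : ∀ f, Tendsto (fun t => D.formAt t f g) (𝓝[>] 0) (𝓝 ⟪f, -h⟫_ℂ) := fun f => by
    have := (tendsto_const_nhds (x := f)).inner (𝕜 := ℂ) hg.neg
    refine this.congr fun t => ?_
    rw [formAt, ← smul_neg, neg_sub, inner_smul_right, div_eq_inv_mul]
  have hdom : g ∈ D.dom := by
    have h1 := (Complex.continuous_re.tendsto _).comp (key g)
    have h2 : Tendsto (fun t => ENNReal.ofReal (D.energyAt t g)) (𝓝[>] 0)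
        (𝓝 (ENNReal.ofReal (⟪g, -h⟫_ℂ).re)) := by
      refine (ENNReal.tendsto_ofReal h1).congr fun t => ?_
      simp only [Function.comp, formAt, energyAt]
      rw [← Complex.div_ofReal_re]
    have := tendsto_nhds_unique h2 (D.tendsto_energyAt_ofReal g)
    change D.energy g < ∞
    rw [← this]; exact ENNReal.ofReal_lt_top
  exact ⟨hdom, fun f hf => tendsto_nhds_unique (D.tendsto_formAt hf hdom) (key f)⟩

end DirichletSpace

end

noncomputable section

open scoped ENNReal NNReal Topology ComplexConjugate InnerProductSpace CStarAlgebra TensorProduct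
open Filter

namespace DirichletSpace

variable {N : Type*} [CStarAlgebra N] [PartialOrder N] [StarOrderedRing N]
  {X : Type*} [NormedAddCommGroup X] [NormedSpace ℂ X] (D : DirichletSpace N X)

/-- `K_t(a, b) = P_t(a* b) - P_t(a*) b - a* P_t(b) + a* b`. -/
def K (t : ℝ≥0) (a b : N) : N :=
  D.P t (star a * b) - D.P t (star a) * b - star a * D.P t b + star a * b

theorem exists_K_factor {ι : Type*} [Fintype ι] (t : ℝ≥0) (a : ι → N) :
    ∃ V : ι → Option ι → N, ∀ i j, D.K t (a i) (a j) = ∑ r, star (V i r) * V j r := by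
  obtain ⟨C, hC⟩ := exists_cp_factor (D.P t) (fun p : Option ι => p.elim 1 a)
  refine ⟨fun i r => C r (some i) - C r none * a i, fun i j => ?_⟩
  have h1 := hC (some i) (some j)
  have h2 := hC (some i) none
  have h3 := hC none (some j)
  have h4 := hC none none
  simp only [Option.elim_some, Option.elim_none, mul_one, star_one, one_mul, D.P.map_one'] at *
  have h5 : star (a i) * a j = star (a i) * (1 * a j) := by rw [one_mul]
  rw [K, h1, h2, h3, h5, h4]
  simp only [Finset.sum_mul, Finset.mul_sum, ← Finset.sum_sub_distrib, ← Finset.sum_add_distrib]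
  refine Finset.sum_congr rfl fun r _ => ?_
  simp only [star_sub, star_mul]
  noncomm_ring

theorem K_self_nonneg (t : ℝ≥0) (a : N) : 0 ≤ D.K t a a := by
  obtain ⟨V, hV⟩ := D.exists_K_factor t (fun _ : Unit => a)
  rw [hV () ()]
  exact Finset.sum_nonneg fun _ _ => star_mul_self_nonneg _

theorem trace_K (t : ℝ≥0) (a : D.τ.PreL2) :
    D.τ (D.K t (D.τ.val a) (D.τ.val a)) =
      ENNReal.ofReal (2 * (⟪(a : D.τ.L2), a - D.op t a⟫_ℂ).re) := by
  set x := D.τ.val a with hx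
  have h1 : D.K t x x + star (D.P t x) * D.P t x =
      D.P t (star x * x) + star (x - D.P t x) * (x - D.P t x) := by
    rw [K, cp_map_star, star_sub]; noncomm_ring
  have h2 := congrArg D.τ.toFun h1
  rw [D.τ.map_add' _ _ (D.K_self_nonneg t x) (star_mul_self_nonneg _),
    D.τ.map_add' _ _ (D.P_nonneg t (star_mul_self_nonneg _)) (star_mul_self_nonneg _),
    D.trace_P t (star_mul_self_nonneg _), hx, ← D.val_opPre, ← map_sub, ← D.τ.ofReal_norm_sq,
    ← D.τ.ofReal_norm_sq, ← D.τ.ofReal_norm_sq, ← ENNReal.ofReal_add (by positivity)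
      (by positivity), ← hx] at h2
  have h3 : D.τ (D.K t x x) = ENNReal.ofReal (‖a‖ ^ 2 + ‖a - D.opPre t a‖ ^ 2) -
      ENNReal.ofReal (‖D.opPre t a‖ ^ 2) := by
    rw [← h2, ENNReal.add_sub_cancel_right ENNReal.ofReal_ne_top]
  rw [h3, ← ENNReal.ofReal_sub _ (by positivity), op_coe, ← UniformSpace.Completion.coe_sub,
    UniformSpace.Completion.inner_coe]
  congr 1
  have h4 := norm_sub_sq (𝕜 := ℂ) a (D.opPre t a)
  simp only [RCLike.re_to_complex] at h4
  rw [inner_sub_right, Complex.sub_re]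
  have h5 := inner_self_eq_norm_sq (𝕜 := ℂ) a
  simp only [RCLike.re_to_complex] at h5
  rw [h5]
  linarith

theorem K_mul_le (t : ℝ≥0) (a b : N) :
    D.K t (a * b) (a * b) ≤
      (2 * ‖a‖ ^ 2) • D.K t b b + (2 : ℝ) • (star b * D.K t a a * b) := by
  set T1 : N := D.P t (star b * star a * (a * b)) - D.P t (star b * star a * a) * b -
    star b * D.P t (star a * (a * b)) + star b * D.P t (star a * a) * b with hT1
  have hle : star a * a ≤ algebraMap ℝ N (‖a‖ ^ 2) := by
    have := CStarAlgebra.star_mul_le_algebraMap_norm_sq (a := a)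
    exact this
  obtain ⟨d, hd⟩ := exists_eq_star_mul_self (sub_nonneg.2 hle)
  have h1 : T1 ≤ (‖a‖ ^ 2) • D.K t b b := by
    have h := cp_sum_nonneg (D.P t) ![d * b, d] ![1, -b]
    simp only [Fin.sum_univ_two, Matrix.cons_val_zero, Matrix.cons_val_one, star_one, mul_one,
      one_mul, star_neg, star_mul] at h
    rw [← sub_nonneg]
    convert h using 1
    have e1 : star b * star d * (d * b) = (‖a‖ ^ 2) • (star b * b) - star b * star a * (a * b) := by
      rw [mul_assoc, ← mul_assoc (star d), ← hd, Algebra.algebraMap_eq_smul_one]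
      simp only [sub_mul, mul_sub, smul_mul_assoc, mul_smul_comm, one_mul, mul_assoc]
    have e2 : star b * star d * d = (‖a‖ ^ 2) • star b - star b * star a * a := by
      rw [mul_assoc, ← hd, Algebra.algebraMap_eq_smul_one]
      simp only [mul_sub, mul_smul_comm, mul_one, mul_assoc]
    have e3 : star d * (d * b) = (‖a‖ ^ 2) • b - star a * (a * b) := by
      rw [← mul_assoc, ← hd, Algebra.algebraMap_eq_smul_one]
      simp only [sub_mul, smul_mul_assoc, one_mul, mul_assoc]
    have hP : ∀ (r : ℝ) (x : N), D.P t (r • x) = r • D.P t x := fun r x => by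
      rw [← Complex.coe_smul, map_smul, Complex.coe_smul]
    rw [e1, e2, e3, ← hd, Algebra.algebraMap_eq_smul_one, K, hT1]
    simp only [map_sub, hP, D.P.map_one', smul_sub, smul_add, smul_neg, sub_mul, mul_sub, mul_neg, neg_mul,
      smul_mul_assoc, mul_smul_comm, mul_one]
    abel
  have h2 : D.K t (a * b) (a * b) ≤ (2 : ℝ) • T1 + (2 : ℝ) • (star b * D.K t a a * b) := by
    have h := cp_sum_nonneg (D.P t) ![a * b, a, 1] ![1, -(2 : ℝ) • b, a * b]
    simp only [Fin.sum_univ_three, Matrix.cons_val_zero, Matrix.cons_val_one, Matrix.cons_val_two,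
      Matrix.head_cons, Matrix.tail_cons, star_one, mul_one,
      one_mul, star_mul, D.P.map_one', star_smul, star_trivial] at h
    rw [← sub_nonneg]
    convert h using 1
    rw [K, K, hT1]
    simp only [star_mul, two_smul, neg_smul]
    noncomm_ring
  calc _ ≤ _ := h2
    _ ≤ (2 : ℝ) • ((‖a‖ ^ 2) • D.K t b b) + (2 : ℝ) • (star b * D.K t a a * b) := by
      gcongr
    _ = _ := by rw [smul_smul]

theorem energyAt_mul_le (t : ℝ≥0) (ht : 0 < t) (a b c : D.τ.PreL2)
    (hc : D.τ.val c = D.τ.val a * D.τ.val b) :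
    D.energyAt t c ≤ 2 * ‖D.τ.val a‖ ^ 2 * D.energyAt t b + 2 * ‖D.τ.val b‖ ^ 2 * D.energyAt t a := by
  have ht' : (0 : ℝ) < t := ht
  have h0 := fun x : D.τ.PreL2 => D.energyAt_nonneg t x
  have hE : ∀ x : D.τ.PreL2, D.τ (D.K t (D.τ.val x) (D.τ.val x)) =
      ENNReal.ofReal (2 * t * D.energyAt t x) := fun x => by
    rw [trace_K, energyAt]; congr 1; field_simp
  have hK := D.K_mul_le t (D.τ.val a) (D.τ.val b)
  have hK0 : 0 ≤ star (D.τ.val b) * D.K t (D.τ.val a) (D.τ.val a) * D.τ.val b :=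
    star_left_conjugate_nonneg (D.K_self_nonneg t _) _
  have h1 := D.τ.mono (D.K_self_nonneg t _) hK
  rw [D.τ.map_add' _ _ (smul_nonneg (by positivity) (D.K_self_nonneg t _))
    (smul_nonneg (by positivity) hK0), D.τ.map_real_smul _ (by positivity) (D.K_self_nonneg t _),
    D.τ.map_real_smul _ (by positivity) hK0, ← hc, hE, hE] at h1
  have h2 : D.τ (star (D.τ.val b) * D.K t (D.τ.val a) (D.τ.val a) * D.τ.val b) ≤
      ENNReal.ofReal (‖D.τ.val b‖ ^ 2) * ENNReal.ofReal (2 * t * D.energyAt t a) := by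
    obtain ⟨k, hk⟩ := exists_eq_star_mul_self (D.K_self_nonneg t (D.τ.val a))
    rw [← hE, hk]
    have := D.τ.le_mul_right k (D.τ.val b)
    rwa [star_mul, mul_assoc, ← mul_assoc (star k), ← mul_assoc] at this
  have ha := h0 a
  have hb := h0 b
  have h3 := h1.trans (add_le_add le_rfl (mul_le_mul_right h2 _))
  rw [← ENNReal.ofReal_mul (by positivity), ← ENNReal.ofReal_mul (by positivity),
    ← ENNReal.ofReal_mul (by positivity), ← ENNReal.ofReal_add (by positivity) (by positivity),
    ENNReal.ofReal_le_ofReal_iff (by positivity)] at h3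
  have h4 : 2 * (t : ℝ) * D.energyAt t c ≤ 2 * t * (2 * ‖D.τ.val a‖ ^ 2 * D.energyAt t b +
    2 * ‖D.τ.val b‖ ^ 2 * D.energyAt t a) := by linarith
  exact le_of_mul_le_mul_left h4 (by positivity)

theorem opPre_st (t : ℝ≥0) (a : D.τ.PreL2) : D.opPre t (D.τ.st a) = D.τ.st (D.opPre t a) :=
  D.τ.val_inj (by simp [cp_map_star])

theorem energyAt_st (t : ℝ≥0) (a : D.τ.PreL2) :
    D.energyAt t (D.τ.st a : D.τ.PreL2) = D.energyAt t a := by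
  have e : D.τ.st a - D.τ.st (D.opPre t a) = D.τ.st (a - D.opPre t a) := D.τ.val_inj (by simp)
  rw [energyAt, energyAt, op_coe, op_coe, ← UniformSpace.Completion.coe_sub,
    ← UniformSpace.Completion.coe_sub, UniformSpace.Completion.inner_coe,
    UniformSpace.Completion.inner_coe, opPre_st, e, D.τ.inner_st, ← inner_conj_symm,
    Complex.conj_re]

/-- The elements of `N` which belong to `D(ℰ)`. -/
def domN : NonUnitalStarSubalgebra ℂ N where
  carrier := {a | ∃ h : a ∈ D.τ.sqInt, (D.τ.ofN a h : D.τ.L2) ∈ D.dom}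
  zero_mem' := ⟨D.τ.sqInt.zero_mem, D.dom.zero_mem⟩
  add_mem' := by
    rintro a b ⟨ha, ha'⟩ ⟨hb, hb'⟩
    refine ⟨D.τ.sqInt.add_mem ha hb, ?_⟩
    have := D.dom.add_mem ha' hb'
    rwa [← UniformSpace.Completion.coe_add] at this
  smul_mem' := by
    rintro c a ⟨ha, ha'⟩
    refine ⟨D.τ.sqInt.smul_mem c ha, ?_⟩
    have := D.dom.smul_mem c ha'
    rwa [← UniformSpace.Completion.coe_smul] at this
  mul_mem' := by
    rintro a b ⟨ha, ha'⟩ ⟨hb, hb'⟩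
    refine ⟨D.τ.mul_mem_left a hb, ?_⟩
    obtain ⟨C, hC⟩ := D.energy_lt_top_iff.1 ha'
    obtain ⟨C', hC'⟩ := D.energy_lt_top_iff.1 hb'
    refine D.energy_lt_top_iff.2 ⟨2 * ‖a‖ ^ 2 * C' + 2 * ‖b‖ ^ 2 * C, fun t ht => ?_⟩
    refine (D.energyAt_mul_le t ht (D.τ.ofN a ha) (D.τ.ofN b hb) _ rfl).trans ?_
    simp only [NFSTrace.val_ofN]
    have := hC t ht
    have := hC' t ht
    gcongr
  star_mem' := by
    rintro a ⟨ha, ha'⟩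
    refine ⟨D.τ.star_mem ha, ?_⟩
    obtain ⟨C, hC⟩ := D.energy_lt_top_iff.1 ha'
    refine D.energy_lt_top_iff.2 ⟨C, fun t ht => ?_⟩
    exact (D.energyAt_st t (D.τ.ofN a ha)).le.trans (hC t ht)

end DirichletSpace

end

noncomputable section

open scoped ENNReal NNReal Topology ComplexConjugate InnerProductSpace CStarAlgebra TensorProduct
open Filter

namespace DirichletSpace

variable {N : Type*} [CStarAlgebra N] [PartialOrder N] [StarOrderedRing N]
  {X : Type*} [NormedAddCommGroup X] [NormedSpace ℂ X] (D : DirichletSpace N X)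

/-- A regular `C*`-subalgebra `𝒜` of `N`. (The restriction of `τ` to any subalgebra is faithful.) -/
structure RegularSubalgebra where
  alg : NonUnitalStarSubalgebra ℂ N
  isClosed : IsClosed (alg : Set N)
  /-- the restriction of `τ` to `𝒜` is semi-finite for the norm -/
  semifinite : (alg : Set N) ⊆
    closure (Submodule.span ℂ {a : N | a ∈ alg ∧ 0 ≤ a ∧ D.τ a < ∞} : Set N)
  /-- `𝒜 ∩ 𝔫` is norm dense in `𝒜` -/
  sqInt_dense : (alg : Set N) ⊆ closure {a : N | a ∈ alg ∧ a ∈ D.τ.sqInt}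
  /-- `𝒜 ∩ D(ℰ)` is norm dense in `𝒜` -/
  dom_dense : (alg : Set N) ⊆ closure {a : N | a ∈ alg ∧ a ∈ D.domN}
  /-- `𝒜 ∩ D(ℰ)` is dense in `D(ℰ)` for the norm `(‖f‖² + ℰ[f])^(1/2)` -/
  form_dense : ∀ f ∈ D.dom, ∀ ε : ℝ≥0∞, 0 < ε → ∃ a : D.τ.PreL2,
    D.τ.val a ∈ alg ∧ (a : D.τ.L2) ∈ D.dom ∧
      ENNReal.ofReal (‖f - a‖ ^ 2) + D.energy (f - a) < ε

namespace RegularSubalgebra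

variable {D} (A : D.RegularSubalgebra)

instance : IsClosed (A.alg : Set N) := A.isClosed

/-- The `*`-algebra `ℬ = 𝒜 ∩ D(ℰ)`. -/
def B : NonUnitalStarSubalgebra ℂ N := A.alg ⊓ D.domN

/-- The inclusion of `ℬ` into `𝒜`. -/
def incl (a : A.B) : A.alg := ⟨a, a.2.1⟩

/-- The inclusion of `ℬ` into `𝔫`. -/
def pre : A.B →ₗ[ℂ] D.τ.PreL2 where
  toFun a := D.τ.ofN a a.2.2.1
  map_add' _ _ := rfl
  map_smul' _ _ := rfl

@[simp] theorem val_pre (a : A.B) : D.τ.val (A.pre a) = a := rfl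

/-- The inclusion of `ℬ` into `L²(τ)`. -/
def l2 : A.B →ₗ[ℂ] D.τ.L2 where
  toFun a := (A.pre a : D.τ.L2)
  map_add' a b := by rw [map_add, UniformSpace.Completion.coe_add]
  map_smul' c a := by rw [map_smul, UniformSpace.Completion.coe_smul]; rfl

theorem l2_mem (a : A.B) : A.l2 a ∈ D.dom := a.2.2.2

/-- The Dirichlet form on `ℬ`. -/
def E (a b : A.B) : ℂ := D.form (A.l2 a) (A.l2 b)

theorem tendsto_E (a b : A.B) :
    Tendsto (fun t => D.formAt t (A.l2 a) (A.l2 b)) (𝓝[>] 0) (𝓝 (A.E a b)) :=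
  D.tendsto_formAt (A.l2_mem a) (A.l2_mem b)

theorem E_add_left (a b c : A.B) : A.E (a + b) c = A.E a c + A.E b c :=
  tendsto_nhds_unique (A.tendsto_E (a + b) c) (((A.tendsto_E a c).add (A.tendsto_E b c)).congr
    fun t => by simp only [formAt, map_add, inner_add_left, add_div])

theorem E_add_right (a b c : A.B) : A.E a (b + c) = A.E a b + A.E a c :=
  tendsto_nhds_unique (A.tendsto_E a (b + c)) (((A.tendsto_E a b).add (A.tendsto_E a c)).congr
    fun t => by
      simp only [formAt, map_add]
      rw [add_sub_add_comm, inner_add_right, add_div])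

theorem E_smul_left (k : ℂ) (a b : A.B) : A.E (k • a) b = (starRingEnd ℂ) k * A.E a b :=
  tendsto_nhds_unique (A.tendsto_E (k • a) b) (((A.tendsto_E a b).const_mul _).congr
    fun t => by simp only [formAt, map_smul, inner_smul_left, mul_div_assoc])

theorem E_smul_right (k : ℂ) (a b : A.B) : A.E a (k • b) = k * A.E a b :=
  tendsto_nhds_unique (A.tendsto_E a (k • b)) (((A.tendsto_E a b).const_mul _).congr
    fun t => by simp only [formAt, map_smul, ← smul_sub, inner_smul_right, mul_div_assoc])

/-- `⟪a ⊗ b, c ⊗ d⟫ = (ℰ(a, c d b*) + ℰ(a b d*, c) - ℰ(b d*, a* c)) / 2`. -/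
def tensorForm (a b c d : A.B) : ℂ :=
  (A.E a (c * d * star b) + A.E (a * b * star d) c - A.E (b * star d) (star a * c)) / 2

/-- The form `⟪·, ·⟫` on `ℬ ⊗ ℬ`, antilinear in the first variable, whose value at
`a ⊗ b`, `c ⊗ d` is `tensorForm a b c d`. -/
def preInner : (A.B ⊗[ℂ] A.B) →ₗ⋆[ℂ] (A.B ⊗[ℂ] A.B) →ₗ[ℂ] ℂ :=
  TensorProduct.lift (LinearMap.mk₂'ₛₗ (starRingEnd ℂ) (starRingEnd ℂ)
    (fun a b => TensorProduct.lift (LinearMap.mk₂ ℂ (A.tensorForm a b)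
      (fun c c' d => by
        simp only [tensorForm, add_mul, mul_add, E_add_right]; ring)
      (fun k c d => by
        simp only [tensorForm, smul_mul_assoc, mul_smul_comm, E_smul_right, smul_eq_mul]; ring)
      (fun c d d' => by
        simp only [tensorForm, star_add, add_mul, mul_add, E_add_left, E_add_right]; ring)
      (fun k c d => by
        simp only [tensorForm, star_smul, smul_mul_assoc, mul_smul_comm, E_smul_left,
          E_smul_right, smul_eq_mul, Complex.star_def, Complex.conj_conj]; ring)))
    (fun a a' b => TensorProduct.ext' fun c d => by
      simp only [TensorProduct.lift.tmul, LinearMap.mk₂_apply, LinearMap.add_apply, tensorForm,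
        star_add, add_mul, E_add_left, E_add_right]; ring)
    (fun k a b => TensorProduct.ext' fun c d => by
      simp only [TensorProduct.lift.tmul, LinearMap.mk₂_apply, LinearMap.smul_apply, tensorForm,
        star_smul, smul_mul_assoc, E_smul_left, E_smul_right, smul_eq_mul,
        Complex.star_def]; ring)
    (fun a b b' => TensorProduct.ext' fun c d => by
      simp only [TensorProduct.lift.tmul, LinearMap.mk₂_apply, LinearMap.add_apply, tensorForm,
        star_add, add_mul, mul_add, E_add_left, E_add_right]; ring)
    (fun k a b => TensorProduct.ext' fun c d => by
      simp only [TensorProduct.lift.tmul, LinearMap.mk₂_apply, LinearMap.smul_apply, tensorForm,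
        star_smul, smul_mul_assoc, mul_smul_comm, E_smul_left, E_smul_right, smul_eq_mul,
        Complex.star_def]; ring))

@[simp] theorem preInner_tmul (a b c d : A.B) :
    A.preInner (a ⊗ₜ b) (c ⊗ₜ d) = A.tensorForm a b c d := rfl

/-- `K_t(c, a)` as an element of `𝔫`. -/
def kap (t : ℝ≥0) (c a : A.B) : D.τ.PreL2 :=
  D.opPre t (D.τ.lmul (star (c : N)) (A.pre a)) - D.τ.lmul (D.P t (star (c : N))) (A.pre a) -
    D.τ.lmul (star (c : N)) (D.opPre t (A.pre a)) + D.τ.lmul (star (c : N)) (A.pre a)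

theorem val_kap (t : ℝ≥0) (c a : A.B) : D.τ.val (A.kap t c a) = D.K t c a := rfl

theorem tendsto_kap (a c d : A.B) :
    Tendsto (fun t : ℝ≥0 => ⟪A.kap t c a, A.pre d⟫_ℂ / (2 * t)) (𝓝[>] 0)
      (𝓝 ((A.E a (c * d) + A.E (a * star d) c - A.E (star d) (star a * c)) / 2)) := by
  refine ((((A.tendsto_E a (c * d)).add (A.tendsto_E (a * star d) c)).sub
    (A.tendsto_E (star d) (star a * c))).div_const 2).congr fun t => ?_
  set a' := A.pre a
  set c' := A.pre c
  set d' := A.pre d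
  have hF : ∀ x y : A.B, D.formAt t (A.l2 x) (A.l2 y) =
      (⟪A.pre x, A.pre y⟫_ℂ - ⟪A.pre x, D.opPre t (A.pre y)⟫_ℂ) / t := fun x y => by
    change ⟪(A.pre x : D.τ.L2), (A.pre y : D.τ.L2) - D.op t (A.pre y : D.τ.L2)⟫_ℂ / _ = _
    rw [op_coe, ← UniformSpace.Completion.coe_sub, UniformSpace.Completion.inner_coe,
      inner_sub_right]
  have e1 : A.pre (c * d) = D.τ.lmul c d' := rfl
  have e1' : A.pre (c * d) = D.τ.rmul d c' := rfl
  have e2 : A.pre (a * star d) = D.τ.rmul (star (d : N)) a' := rfl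
  have e2' : A.pre (a * star d) = D.τ.lmul a (A.pre (star d)) := rfl
  have e3 : A.pre (star d) = D.τ.st d' := rfl
  have e4 : A.pre (star a * c) = D.τ.lmul (star (a : N)) c' := rfl
  have e5 : A.pre (star a * c) = D.τ.st (D.τ.lmul (star (c : N)) a') := D.τ.val_inj (by
    simp [a'])
  have i1 : ⟪a', A.pre (c * d)⟫_ℂ = ⟪D.τ.lmul (star (c : N)) a', d'⟫_ℂ := by
    rw [e1, D.τ.inner_lmul, star_star]
  have i2 : ⟪a', D.opPre t (A.pre (c * d))⟫_ℂ =
      ⟪D.τ.lmul (star (c : N)) (D.opPre t a'), d'⟫_ℂ := by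
    rw [e1, ← D.opPre_symm, D.τ.inner_lmul, star_star]
  have i3 : ⟪A.pre (a * star d), c'⟫_ℂ = ⟪A.pre (star d), A.pre (star a * c)⟫_ℂ := by
    rw [e2', e4, D.τ.inner_lmul]
  have i4 : ⟪A.pre (a * star d), D.opPre t c'⟫_ℂ =
      ⟪D.τ.lmul (D.P t (star (c : N))) a', d'⟫_ℂ := by
    rw [e2, D.τ.inner_rmul, star_star, D.τ.inner_lmul, cp_map_star, star_star]
    rfl
  have i5 : ⟪A.pre (star d), D.opPre t (A.pre (star a * c))⟫_ℂ =
      ⟪D.opPre t (D.τ.lmul (star (c : N)) a'), d'⟫_ℂ := by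
    rw [e3, e5, D.opPre_st, D.τ.inner_st]
  rw [hF, hF, hF, i1, i2, i3, i4, i5, kap, inner_add_left, inner_sub_left, inner_sub_left]
  ring

/-- The squared norm of `∑ f_i ⊗ g_i` is a limit of sums of squares. -/
theorem kap_sum_eq {ι κ : Type*} [Fintype ι] [Fintype κ] (t : ℝ≥0) (f g : ι → A.B)
    (V : ι → κ → N) (hV : ∀ i j, D.K t (f i) (f j) = ∑ r, star (V i r) * V j r) :
    ∑ i, ∑ j, ⟪A.kap t (f j) (f i), A.pre (g j * star (g i))⟫_ℂ =
      ((∑ r, ‖∑ i, D.τ.lmul (V i r) (A.pre (g i))‖ ^ 2 : ℝ) : ℂ) := by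
  have h1 : ∀ i j, ⟪A.kap t (f j) (f i), A.pre (g j * star (g i))⟫_ℂ =
      ∑ r, ⟪D.τ.lmul (V i r) (A.pre (g i)), D.τ.lmul (V j r) (A.pre (g j))⟫_ℂ := fun i j => by
    have e1 : A.pre (g j * star (g i)) = D.τ.rmul (star (g i : N)) (A.pre (g j)) := rfl
    have e2 : D.τ.rmul (g i : N) (A.kap t (f j) (f i)) =
        ∑ r, D.τ.lmul (star (V j r)) (D.τ.lmul (V i r) (A.pre (g i))) := D.τ.val_inj (by
      simp only [NFSTrace.val_rmul, val_kap, hV, map_sum, NFSTrace.val_lmul, val_pre,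
        Finset.sum_mul, mul_assoc])
    rw [e1, ← D.τ.inner_rmul, e2, sum_inner]
    exact Finset.sum_congr rfl fun r _ => by rw [D.τ.inner_lmul, star_star]
  simp only [h1]
  push_cast
  calc _ = ∑ i, ∑ r, ∑ j, ⟪D.τ.lmul (V i r) (A.pre (g i)), D.τ.lmul (V j r) (A.pre (g j))⟫_ℂ :=
        Finset.sum_congr rfl fun i _ => Finset.sum_comm
    _ = ∑ r, ∑ i, ∑ j, ⟪D.τ.lmul (V i r) (A.pre (g i)), D.τ.lmul (V j r) (A.pre (g j))⟫_ℂ :=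
        Finset.sum_comm
    _ = _ := Finset.sum_congr rfl fun r _ => by
        rw [← Complex.ofReal_pow, ← inner_self_eq_norm_sq (𝕜 := ℂ)]
        have : ((RCLike.re ⟪∑ i, D.τ.lmul (V i r) (A.pre (g i)),
            ∑ i, D.τ.lmul (V i r) (A.pre (g i))⟫_ℂ : ℝ) : ℂ) =
            ⟪∑ i, D.τ.lmul (V i r) (A.pre (g i)), ∑ i, D.τ.lmul (V i r) (A.pre (g i))⟫_ℂ :=
          Complex.ext (Complex.ofReal_re _) ((Complex.ofReal_im _).trans
            (inner_self_im (𝕜 := ℂ) (∑ i, D.τ.lmul (V i r) (A.pre (g i)))).symm)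
        rw [this, sum_inner]
        exact Finset.sum_congr rfl fun i _ => by rw [inner_sum]

theorem tensorForm_eq (a b c d : A.B) : A.tensorForm a b c d =
    (A.E a (c * (d * star b)) + A.E (a * star (d * star b)) c -
      A.E (star (d * star b)) (star a * c)) / 2 := by
  simp only [tensorForm, star_mul, star_star, mul_assoc]

theorem tendsto_preInner {n : ℕ} (f g : Fin n → A.B) :
    Tendsto (fun t : ℝ≥0 => (∑ i, ∑ j, ⟪A.kap t (f j) (f i), A.pre (g j * star (g i))⟫_ℂ) / (2 * t))
      (𝓝[>] 0) (𝓝 (A.preInner (∑ i, f i ⊗ₜ g i) (∑ i, f i ⊗ₜ g i))) := by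
  have h : A.preInner (∑ i, f i ⊗ₜ g i) (∑ i, f i ⊗ₜ g i) =
      ∑ i, ∑ j, A.tensorForm (f i) (g i) (f j) (g j) := by
    simp only [map_sum, LinearMap.sum_apply, preInner_tmul]
    exact Finset.sum_comm
  rw [h]
  refine (tendsto_finsetSum _ fun i _ => tendsto_finsetSum _ fun j _ => ?_ :
    Tendsto (fun t : ℝ≥0 => ∑ i, ∑ j, ⟪A.kap t (f j) (f i), A.pre (g j * star (g i))⟫_ℂ / (2 * t))
    _ _).congr fun t => by simp only [Finset.sum_div]
  rw [tensorForm_eq]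
  exact A.tendsto_kap (f i) (f j) (g j * star (g i))

theorem preInner_self_nonneg (x : A.B ⊗[ℂ] A.B) :
    0 ≤ (A.preInner x x).re ∧ (A.preInner x x).im = 0 := by
  obtain ⟨n, f, g, rfl⟩ := TensorProduct.exists_sum_tmul_eq x
  have h := A.tendsto_preInner f g
  have key : ∀ t : ℝ≥0, ∃ s : ℝ, 0 ≤ s ∧
      (∑ i, ∑ j, ⟪A.kap t (f j) (f i), A.pre (g j * star (g i))⟫_ℂ) / (2 * t) = (s : ℂ) := by
    intro t
    obtain ⟨V, hV⟩ := D.exists_K_factor t (fun i => (f i : N))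
    rw [A.kap_sum_eq t f g V hV]
    refine ⟨(∑ r, ‖∑ i, D.τ.lmul (V i r) (A.pre (g i))‖ ^ 2) / (2 * t), by positivity, ?_⟩
    push_cast; rfl
  choose s hs0 hs using key
  constructor
  · refine ge_of_tendsto ((Complex.continuous_re.tendsto _).comp h) (Eventually.of_forall fun t => ?_)
    simp only [Function.comp, hs]; exact hs0 t
  · refine tendsto_nhds_unique ((Complex.continuous_im.tendsto _).comp h)
      (tendsto_const_nhds.congr fun t => ?_)
    simp only [Function.comp, hs, Complex.ofReal_im]

theorem preInner_conj (x y : A.B ⊗[ℂ] A.B) :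
    (starRingEnd ℂ) (A.preInner y x) = A.preInner x y := by
  have h1 := (A.preInner_self_nonneg (x + y)).2
  have h2 := (A.preInner_self_nonneg (x + Complex.I • y)).2
  have hx := (A.preInner_self_nonneg x).2
  have hy := (A.preInner_self_nonneg y).2
  simp only [map_add, LinearMap.add_apply, map_smulₛₗ, LinearMap.smul_apply, smul_eq_mul,
    RingHom.id_apply, Complex.conj_I, Complex.add_im, Complex.mul_im, Complex.I_re, Complex.I_im,
    Complex.neg_re, Complex.neg_im, Complex.mul_re, Complex.add_re] at h1 h2
  apply Complex.ext
  · simp only [Complex.conj_re]; linarith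
  · simp only [Complex.conj_im]; linarith

/-- `ℬ ⊗ ℬ` with its semi-inner product. -/
def PreTangent : Type _ := A.B ⊗[ℂ] A.B

instance : AddCommGroup A.PreTangent := inferInstanceAs (AddCommGroup (A.B ⊗[ℂ] A.B))
instance : Module ℂ A.PreTangent := inferInstanceAs (Module ℂ (A.B ⊗[ℂ] A.B))

/-- The semi-inner product of `ℬ ⊗ ℬ`. -/
@[reducible] def preCore : PreInnerProductSpace.Core ℂ A.PreTangent where
  inner x y := A.preInner x y
  conj_inner_symm x y := A.preInner_conj x y
  re_inner_nonneg x := (A.preInner_self_nonneg x).1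
  add_left x y z := LinearMap.congr_fun (LinearMap.map_add A.preInner x y) z
  smul_left x y r := LinearMap.congr_fun (LinearMap.map_smulₛₗ A.preInner r x) y

instance : SeminormedAddCommGroup A.PreTangent :=
  @InnerProductSpace.Core.toSeminormedAddCommGroup ℂ A.PreTangent _ _ _ A.preCore

instance : InnerProductSpace ℂ A.PreTangent := InnerProductSpace.ofCore A.preCore

/-- The Cipriani–Sauvageot tangent space `ℋ`: the Hilbert space obtained from `ℬ ⊗ ℬ` by dividing
by the kernel of the seminorm and completing. -/
abbrev H : Type _ := UniformSpace.Completion A.PreTangent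

/-- The element `a ⊗ b` of `ℬ ⊗ ℬ`. -/
def ptmul (a b : A.B) : A.PreTangent := (a ⊗ₜ[ℂ] b : A.B ⊗[ℂ] A.B)

/-- The class of `a ⊗ b` in `ℋ`. -/
def tmul (a b : A.B) : A.H := (A.ptmul a b : A.H)

theorem inner_pre (x y : A.PreTangent) : ⟪(x : A.H), (y : A.H)⟫_ℂ = A.preInner x y :=
  UniformSpace.Completion.inner_coe _ _

theorem inner_tmul (a b c d : A.B) : ⟪A.tmul a b, A.tmul c d⟫_ℂ =
    (A.E a (c * d * star b) + A.E (a * b * star d) c - A.E (b * star d) (star a * c)) / 2 :=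
  A.inner_pre (A.ptmul a b) (A.ptmul c d)

end RegularSubalgebra

end DirichletSpace

end

noncomputable section

open scoped ENNReal NNReal Topology ComplexConjugate InnerProductSpace CStarAlgebra TensorProduct
open Filter

namespace DirichletSpace

namespace RegularSubalgebra

variable {N : Type*} [CStarAlgebra N] [PartialOrder N] [StarOrderedRing N]
  {X : Type*} [NormedAddCommGroup X] [NormedSpace ℂ X] {D : DirichletSpace N X}
  (A : D.RegularSubalgebra)

theorem norm_sq_pre (x : A.PreTangent) : ‖x‖ ^ 2 = (A.preInner x x).re :=
  (inner_self_eq_norm_sq (𝕜 := ℂ) x).symm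

/-- The right multiplication `a ⊗ b ↦ a ⊗ (b f)` by `f ∈ ℬ` on `ℬ ⊗ ℬ`. -/
def pmulR (f : A.B) : A.PreTangent →ₗ[ℂ] A.PreTangent :=
  LinearMap.lTensor A.B (LinearMap.mulRight ℂ f)

theorem pmulR_ptmul (f a b : A.B) : A.pmulR f (A.ptmul a b) = A.ptmul a (b * f) := rfl

theorem pre_induction {p : A.PreTangent → Prop} (h0 : p 0)
    (ht : ∀ a b, p (A.ptmul a b)) (ha : ∀ x y, p x → p y → p (x + y)) (x : A.PreTangent) : p x :=
  TensorProduct.induction_on (motive := p) x h0 ht ha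

theorem norm_pmulR_le (f : A.B) (x : A.PreTangent) : ‖A.pmulR f x‖ ≤ ‖(f : N)‖ * ‖x‖ := by
  refine abs_le_of_sq_le_sq' ?_ (by positivity) |>.2
  rw [mul_pow, norm_sq_pre, norm_sq_pre]
  obtain ⟨n, a, g, hx⟩ := TensorProduct.exists_sum_tmul_eq (R := ℂ) x
  have hxf : A.pmulR f x = ∑ i, (a i ⊗ₜ[ℂ] (g i * f) : A.B ⊗[ℂ] A.B) := by
    rw [hx, pmulR]
    exact map_sum (LinearMap.lTensor A.B (LinearMap.mulRight ℂ f)) _ _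
  have h1 := (Complex.continuous_re.tendsto _).comp (A.tendsto_preInner a g)
  have h2 := (Complex.continuous_re.tendsto _).comp (A.tendsto_preInner a (fun i => g i * f))
  rw [hxf]
  rw [hx]
  refine le_of_tendsto_of_tendsto h2 (h1.const_mul _) (Eventually.of_forall fun t => ?_)
  obtain ⟨V, hV⟩ := D.exists_K_factor t (fun i => (a i : N))
  simp only [Function.comp]
  rw [A.kap_sum_eq t a g V hV, A.kap_sum_eq t a (fun i => g i * f) V hV]
  have e : ∀ s : ℝ, ((s : ℂ) / (2 * t)).re = s / (2 * t) := fun s => by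
    rw [← Complex.ofReal_re (s / (2 * t))]; congr 1; push_cast; rfl
  rw [e, e, ← mul_div_assoc]
  refine div_le_div_of_nonneg_right ?_ (by positivity)
  rw [Finset.mul_sum]
  refine Finset.sum_le_sum fun r _ => ?_
  have e2 : ∑ i, D.τ.lmul (V i r) (A.pre (g i * f)) =
      D.τ.rmul (f : N) (∑ i, D.τ.lmul (V i r) (A.pre (g i))) := D.τ.val_inj (by
    simp [mul_assoc])
  rw [e2, ← mul_pow]
  exact pow_le_pow_left₀ (norm_nonneg _) (D.τ.norm_rmul_le _ _) 2

theorem pmulR_add (f g : A.B) (x : A.PreTangent) :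
    A.pmulR (f + g) x = A.pmulR f x + A.pmulR g x := by
  refine A.pre_induction (p := fun x => A.pmulR (f + g) x = A.pmulR f x + A.pmulR g x)
    (by simp) (fun a b => ?_) (fun x y hx hy => ?_) x
  · rw [pmulR_ptmul, pmulR_ptmul, pmulR_ptmul, mul_add]
    exact TensorProduct.tmul_add _ _ _
  · rw [map_add, hx, hy, map_add, map_add]; abel

theorem pmulR_smul (c : ℂ) (f : A.B) (x : A.PreTangent) :
    A.pmulR (c • f) x = c • A.pmulR f x := by
  refine A.pre_induction (p := fun x => A.pmulR (c • f) x = c • A.pmulR f x)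
    (by simp) (fun a b => ?_) (fun x y hx hy => ?_) x
  · rw [pmulR_ptmul, pmulR_ptmul, mul_smul_comm]
    exact TensorProduct.tmul_smul _ _ _
  · rw [map_add, hx, hy, map_add, smul_add]

/-- The right multiplication by `f ∈ ℬ` on `ℋ`. -/
def mulR (f : A.B) : A.H →L[ℂ] A.H :=
  ((A.pmulR f).mkContinuous ‖(f : N)‖ (A.norm_pmulR_le f)).completion

theorem mulR_coe (f : A.B) (x : A.PreTangent) : A.mulR f (x : A.H) = (A.pmulR f x : A.H) :=
  ContinuousLinearMap.completion_apply_coe _ _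

theorem mulR_add (f g : A.B) (x : A.H) : A.mulR (f + g) x = A.mulR f x + A.mulR g x := by
  refine UniformSpace.Completion.induction_on x (isClosed_eq (A.mulR (f + g)).continuous
    ((A.mulR f).continuous.add (A.mulR g).continuous)) fun x => ?_
  rw [mulR_coe, mulR_coe, mulR_coe, pmulR_add, UniformSpace.Completion.coe_add]

theorem mulR_smul (c : ℂ) (f : A.B) (x : A.H) : A.mulR (c • f) x = c • A.mulR f x := by
  refine UniformSpace.Completion.induction_on x (isClosed_eq (A.mulR (c • f)).continuous
    ((A.mulR f).continuous.const_smul c)) fun x => ?_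
  rw [mulR_coe, mulR_coe, pmulR_smul, UniformSpace.Completion.coe_smul]

/-- The right action of `ℬ` on `ℋ`. -/
def actB : A.B →ₗ[ℂ] (A.H →L[ℂ] A.H) where
  toFun := A.mulR
  map_add' f g := ContinuousLinearMap.ext fun x => A.mulR_add f g x
  map_smul' c f := ContinuousLinearMap.ext fun x => A.mulR_smul c f x

theorem actB_coe (f : A.B) (x : A.PreTangent) : A.actB f (x : A.H) = (A.pmulR f x : A.H) :=
  A.mulR_coe f x

theorem actB_tmul (f a b : A.B) : A.actB f (A.tmul a b) = A.tmul a (b * f) :=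
  A.actB_coe f _

theorem norm_actB_le (f : A.B) : ‖A.actB f‖ ≤ ‖(f : N)‖ := by
  refine ContinuousLinearMap.opNorm_le_bound _ (norm_nonneg _) fun x => ?_
  refine UniformSpace.Completion.induction_on x
    (isClosed_le (by fun_prop) (by fun_prop)) fun x => ?_
  rw [actB_coe, UniformSpace.Completion.norm_coe, UniformSpace.Completion.norm_coe]
  exact A.norm_pmulR_le f x

/-- The inclusion of `ℬ` into `𝒜` as a linear map. -/
def inclL : A.B →ₗ[ℂ] A.alg where
  toFun := A.incl
  map_add' _ _ := rfl
  map_smul' _ _ := rfl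

theorem denseRange_inclL : DenseRange A.inclL := by
  intro a
  rw [mem_closure_iff_seq_limit]
  obtain ⟨u, hu, hu'⟩ := mem_closure_iff_seq_limit.1 (A.dom_dense a.2)
  refine ⟨fun n => ⟨u n, (hu n).1⟩, fun n => ⟨⟨u n, hu n⟩, rfl⟩, ?_⟩
  exact tendsto_subtype_rng.2 hu'

/-- The right action of `𝒜` on `ℋ`, the continuous extension of the right action of `ℬ`. -/
def rightAct : A.alg →L[ℂ] (A.H →L[ℂ] A.H) := A.actB.extendOfNorm A.inclL

theorem rightAct_incl (f : A.B) : A.rightAct (A.incl f) = A.actB f :=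
  LinearMap.extendOfNorm_eq A.denseRange_inclL ⟨1, fun f => by
    rw [one_mul]; exact A.norm_actB_le f⟩ f

theorem rightAct_tmul (f a b : A.B) :
    A.rightAct (A.incl f) (A.tmul a b) = A.tmul a (b * f) := by
  rw [rightAct_incl, actB_tmul]

end RegularSubalgebra

end DirichletSpace

end

noncomputable section

open scoped ENNReal NNReal Topology ComplexConjugate InnerProductSpace CStarAlgebra TensorProduct
open Filter

namespace DirichletSpace

namespace RegularSubalgebra

variable {N : Type*} [CStarAlgebra N] [PartialOrder N] [StarOrderedRing N]
  {X : Type*} [NormedAddCommGroup X] [NormedSpace ℂ X] {D : DirichletSpace N X}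
  (A : D.RegularSubalgebra)

/-- The functional `c ⊗ d ↦ ⟪∂a, c ⊗ d⟫` on `ℬ ⊗ ℬ`. -/
def gradForm (a : A.B) : A.PreTangent →ₗ[ℂ] ℂ :=
  TensorProduct.lift (LinearMap.mk₂ ℂ
    (fun c d => (A.E a (c * d) + A.E (a * star d) c - A.E (star d) (star a * c)) / 2)
    (fun c c' d => by simp only [add_mul, mul_add, E_add_right]; ring)
    (fun k c d => by
      simp only [smul_mul_assoc, mul_smul_comm, E_smul_right, smul_eq_mul]; ring)
    (fun c d d' => by simp only [star_add, mul_add, E_add_left, E_add_right]; ring)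
    (fun k c d => by
      simp only [star_smul, mul_smul_comm, E_smul_left,
        E_smul_right, smul_eq_mul, Complex.star_def, Complex.conj_conj]; ring))

theorem gradForm_ptmul (a c d : A.B) : A.gradForm a (A.ptmul c d) =
    (A.E a (c * d) + A.E (a * star d) c - A.E (star d) (star a * c)) / 2 := rfl

theorem kap_bound (t : ℝ≥0) (ht : 0 < t) (a : A.B) {n : ℕ} (c d : Fin n → A.B) :
    ‖∑ i, ⟪A.kap t (c i) a, A.pre (d i)⟫_ℂ‖ ^ 2 ≤ (2 * t * D.energyAt t (A.l2 a)) *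
      (∑ i, ∑ j, ⟪A.kap t (c j) (c i), A.pre (d j * star (d i))⟫_ℂ).re := by
  have ht' : (0 : ℝ) < t := ht
  obtain ⟨V, hV⟩ := D.exists_K_factor t (fun p : Option (Fin n) => p.elim (a : N) (fun i => c i))
  have hVa : D.K t a a = ∑ r, star (V none r) * V none r := hV none none
  have hle : ∀ r, star (V none r) * V none r ≤ D.K t a a := fun r => by
    rw [hVa]
    exact Finset.single_le_sum (f := fun r => star (V none r) * V none r)
      (fun _ _ => star_mul_self_nonneg _) (Finset.mem_univ r)
  have hK : D.τ (D.K t a a) = ENNReal.ofReal (2 * t * D.energyAt t (A.l2 a)) := by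
    refine (D.trace_K t (A.pre a)).trans ?_
    rw [energyAt]; congr 1; field_simp; rfl
  have hmem : ∀ r, V none r ∈ D.τ.sqInt := fun r => D.τ.mem_sqInt.2
    ((D.τ.mono (star_mul_self_nonneg _) (hle r)).trans_lt (by rw [hK]; exact ENNReal.ofReal_lt_top))
  set v : Option (Option (Fin n)) → D.τ.PreL2 := fun r => D.τ.ofN (V none r) (hmem r) with hv
  set w : Option (Option (Fin n)) → D.τ.PreL2 := fun r =>
    ∑ i, D.τ.lmul (V (some i) r) (A.pre (d i)) with hw
  have h1 : ∑ i, ⟪A.kap t (c i) a, A.pre (d i)⟫_ℂ = ∑ r, ⟪v r, w r⟫_ℂ := by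
    have e : ∀ i, A.kap t (c i) a = ∑ r, D.τ.lmul (star (V (some i) r)) (v r) := fun i =>
      D.τ.val_inj (by
        rw [val_kap, map_sum]
        exact hV (some i) none)
    simp only [e, sum_inner, hw, inner_sum]
    rw [Finset.sum_comm]
    refine Finset.sum_congr rfl fun r _ => Finset.sum_congr rfl fun i _ => ?_
    rw [D.τ.inner_lmul, star_star]
  have h2 : ∑ r, ‖v r‖ ^ 2 = 2 * t * D.energyAt t (A.l2 a) := by
    rw [← ENNReal.ofReal_eq_ofReal_iff (by positivity)
      (by have := D.energyAt_nonneg t (A.l2 a); positivity), ← hK, hVa,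
      D.τ.map_sum _ _ fun _ _ => star_mul_self_nonneg _,
      ENNReal.ofReal_sum_of_nonneg fun _ _ => by positivity]
    exact Finset.sum_congr rfl fun r _ => D.τ.ofReal_norm_sq _
  rw [A.kap_sum_eq t c d (fun i r => V (some i) r) (fun i j => hV (some i) (some j)), h1,
    Complex.ofReal_re, ← h2]
  calc ‖∑ r, ⟪v r, w r⟫_ℂ‖ ^ 2 ≤ (∑ r, ‖v r‖ * ‖w r‖) ^ 2 := by
        gcongr
        exact (norm_sum_le _ _).trans (Finset.sum_le_sum fun r _ => norm_inner_le_norm _ _)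
    _ ≤ _ := Finset.sum_mul_sq_le_sq_mul_sq _ _ _

theorem gradForm_bound (a : A.B) : ∃ C : ℝ, ∀ x : A.PreTangent, ‖A.gradForm a x‖ ≤ C * ‖x‖ := by
  obtain ⟨C, hC⟩ := D.energy_lt_top_iff.1 (A.l2_mem a)
  refine ⟨√C, fun x => ?_⟩
  have hC0 : 0 ≤ C := (D.energyAt_nonneg 1 (A.pre a)).trans (hC 1 one_pos)
  refine abs_le_of_sq_le_sq' ?_ (by positivity) |>.2
  rw [mul_pow, Real.sq_sqrt hC0, norm_sq_pre]
  obtain ⟨n, c, d, hx⟩ := TensorProduct.exists_sum_tmul_eq (R := ℂ) x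
  have hx' : A.gradForm a x = ∑ i, (A.E a (c i * d i) + A.E (a * star (d i)) (c i) -
      A.E (star (d i)) (star a * c i)) / 2 := by
    rw [hx]
    exact map_sum (A.gradForm a) (fun i => A.ptmul (c i) (d i)) _
  have h1 := ((Complex.continuous_re.tendsto _).comp (A.tendsto_preInner c d)).const_mul C
  have h2 := ((tendsto_finsetSum Finset.univ fun i _ => A.tendsto_kap a (c i) (d i)).norm).pow 2
  rw [← hx'] at h2
  rw [← hx] at h1
  refine le_of_tendsto_of_tendsto h2 h1 ?_
  filter_upwards [self_mem_nhdsWithin] with t ht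
  have ht' : (0 : ℝ) < t := ht
  have h3 := A.kap_bound t ht a c d
  set S := (∑ i, ∑ j, ⟪A.kap t (c j) (c i), A.pre (d j * star (d i))⟫_ℂ) with hS
  have e : ((2 : ℂ) * (t : ℂ)) = ((2 * t : ℝ) : ℂ) := by push_cast; rfl
  have h4 : 0 ≤ S.re := by
    obtain ⟨V, hV⟩ := D.exists_K_factor t (fun i => (c i : N))
    rw [hS, A.kap_sum_eq t c d V hV, Complex.ofReal_re]
    positivity
  have h5 := hC t ht
  simp only [Function.comp]
  rw [← Finset.sum_div, norm_div, div_pow, e, Complex.div_ofReal_re, Complex.norm_real,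
    Real.norm_of_nonneg (by positivity), div_le_iff₀ (by positivity)]
  calc _ ≤ _ := h3
    _ ≤ (2 * t * C) * S.re := by gcongr
    _ = _ := by rw [hS]; field_simp

theorem inner_actB (f : A.B) (x y : A.H) :
    ⟪A.actB f x, y⟫_ℂ = ⟪x, A.actB (star f) y⟫_ℂ := by
  refine UniformSpace.Completion.induction_on₂ x y (isClosed_eq (by fun_prop) (by fun_prop))
    fun x y => ?_
  rw [actB_coe, actB_coe]
  refine A.pre_induction (p := fun x => ⟪(A.pmulR f x : A.H), (y : A.H)⟫_ℂ =
    ⟪(x : A.H), (A.pmulR (star f) y : A.H)⟫_ℂ) (by simp) (fun a b => ?_) (fun x x' hx hx' => ?_) x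
  · refine A.pre_induction (p := fun y => ⟪(A.pmulR f (A.ptmul a b) : A.H), (y : A.H)⟫_ℂ =
      ⟪(A.ptmul a b : A.H), (A.pmulR (star f) y : A.H)⟫_ℂ) ?_ (fun c d => ?_)
      (fun y y' hy hy' => ?_) y
    · rw [map_zero, UniformSpace.Completion.coe_zero, inner_zero_right, inner_zero_right]
    · rw [pmulR_ptmul, pmulR_ptmul]
      change ⟪A.tmul _ _, A.tmul _ _⟫_ℂ = ⟪A.tmul _ _, A.tmul _ _⟫_ℂ
      rw [inner_tmul, inner_tmul]
      simp only [star_mul, star_star, mul_assoc]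
    · rw [map_add, UniformSpace.Completion.coe_add, UniformSpace.Completion.coe_add,
        inner_add_right, inner_add_right, hy, hy']
  · rw [map_add, UniformSpace.Completion.coe_add, UniformSpace.Completion.coe_add,
      inner_add_left, inner_add_left, hx, hx']

theorem ext_inner_tmul {x y : A.H} (h : ∀ c d, ⟪x, A.tmul c d⟫_ℂ = ⟪y, A.tmul c d⟫_ℂ) : x = y := by
  refine ext_inner_right ℂ fun z => ?_
  refine UniformSpace.Completion.induction_on z (isClosed_eq (by fun_prop) (by fun_prop))
    fun z => ?_
  refine A.pre_induction (p := fun z => ⟪x, (z : A.H)⟫_ℂ = ⟪y, (z : A.H)⟫_ℂ) ?_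
    (fun c d => h c d) (fun z z' hz hz' => ?_) z
  · rw [UniformSpace.Completion.coe_zero, inner_zero_right, inner_zero_right]
  rw [UniformSpace.Completion.coe_add, inner_add_right, inner_add_right, hz, hz']

theorem exists_grad (a : A.B) : ∃ ξ : A.H, ∀ b : A.B, A.actB b ξ = A.tmul a b := by
  obtain ⟨C, hC⟩ := A.gradForm_bound a
  set L := ((A.gradForm a).mkContinuous C hC).fromCompletion
  refine ⟨(InnerProductSpace.toDual ℂ A.H).symm L, fun b => A.ext_inner_tmul fun c d => ?_⟩
  have h : L (A.tmul c (d * star b)) = A.gradForm a (A.ptmul c (d * star b)) :=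
    ContinuousLinearMap.fromCompletion_apply_coe _ _
  rw [inner_actB, actB_tmul, InnerProductSpace.toDual_symm_apply, h, gradForm_ptmul, inner_tmul]
  simp only [star_mul, star_star, mul_assoc]

theorem exists_approx (d : A.B) (ε : ℝ) (hε : 0 < ε) : ∃ e : A.B, ‖((d - d * e : A.B) : N)‖ < ε := by
  let _ := CStarAlgebra.spectralOrder A.alg
  let _ := CStarAlgebra.spectralOrderedRing A.alg
  have h := (CStarAlgebra.increasingApproximateUnit A.alg).tendsto_mul_left (A.incl d)
  obtain ⟨e, he⟩ := (h.eventually (Metric.ball_mem_nhds _ (half_pos hε))).exists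
  obtain ⟨e', he'⟩ := A.denseRange_inclL.exists_dist_lt e
    (show 0 < ε / 2 / (‖A.incl d‖ + 1) by positivity)
  refine ⟨e', ?_⟩
  have h1 : ‖A.incl d - A.incl d * e‖ < ε / 2 := by
    rw [← dist_eq_norm, dist_comm]; exact he
  have h2 : ‖A.incl d * (e - A.incl e')‖ < ε / 2 := by
    rw [dist_eq_norm, lt_div_iff₀ (by positivity)] at he'
    refine lt_of_le_of_lt ?_ he'
    refine (norm_mul_le _ _).trans ?_
    rw [mul_comm]
    gcongr
    · exact le_rfl
    · exact (le_add_iff_nonneg_right _).2 (zero_le_one' ℝ)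
  have h3 : ‖A.incl d - A.incl d * A.incl e'‖ < ε := by
    have : A.incl d - A.incl d * A.incl e' =
      (A.incl d - A.incl d * e) + A.incl d * (e - A.incl e') := by rw [mul_sub]; abel
    rw [this]
    exact (norm_add_le _ _).trans_lt (by linarith)
  exact h3

theorem existsUnique_grad (a : A.B) : ∃! ξ : A.H, ∀ b : A.B, A.actB b ξ = A.tmul a b := by
  obtain ⟨ξ, hξ⟩ := A.exists_grad a
  refine ⟨ξ, hξ, fun η hη => A.ext_inner_tmul fun c d => ?_⟩
  obtain ⟨ζ, hζ⟩ := A.exists_grad c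
  rw [← sub_eq_zero, ← inner_sub_left]
  have h0 : ∀ b, A.actB b (η - ξ) = 0 := fun b => by rw [map_sub, hξ, hη, sub_self]
  refine norm_le_zero_iff.1 (le_of_forall_pos_lt_add fun ε hε => ?_)
  obtain ⟨e, he⟩ := A.exists_approx d (ε / (‖η - ξ‖ * ‖ζ‖ + 1)) (by positivity)
  have h1 : ⟪η - ξ, A.tmul c d⟫_ℂ = ⟪η - ξ, A.actB (d - d * e) ζ⟫_ℂ := by
    rw [map_sub, sub_apply, hζ, hζ, inner_sub_right, ← A.actB_tmul e c d]
    have := A.inner_actB (star e) (η - ξ) (A.tmul c d)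
    rw [h0, inner_zero_left, star_star] at this
    rw [← this, sub_zero]
  rw [h1, zero_add]
  rw [lt_div_iff₀ (by positivity)] at he
  calc _ ≤ ‖η - ξ‖ * (‖((d - d * e : A.B) : N)‖ * ‖ζ‖) := (norm_inner_le_norm _ _).trans (by
        gcongr
        exact (ContinuousLinearMap.le_opNorm _ _).trans (by gcongr; exact A.norm_actB_le _))
    _ ≤ ‖((d - d * e : A.B) : N)‖ * (‖η - ξ‖ * ‖ζ‖ + 1) := by
        nlinarith [norm_nonneg ((d - d * e : A.B) : N)]
    _ < ε := he

/-- The derivation `∂ : ℬ → ℋ`: the vector `∂a` is determined by `(∂a) b = a ⊗ b`, `b ∈ ℬ`. -/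
def grad (a : A.B) : A.H := (A.existsUnique_grad a).choose

theorem grad_mul (a b : A.B) : A.rightAct (A.incl b) (A.grad a) = A.tmul a b := by
  rw [rightAct_incl]
  exact (A.existsUnique_grad a).choose_spec.1 b

end RegularSubalgebra

end DirichletSpace

end

noncomputable section

open scoped ENNReal NNReal Topology ComplexConjugate InnerProductSpace CStarAlgebra TensorProduct
open Filter

namespace CStarDual

section

variable {M : Type*} [CStarAlgebra M] [PartialOrder M] [StarOrderedRing M]

theorem norm_comb_sq_le {e x y : M} (he : 0 ≤ e) (he1 : e ≤ 1) (hx : ‖x‖ ≤ 1) (hy : ‖y‖ ≤ 1)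
    (r : ℝ) : ‖e * x + (r : ℂ) • (y - e * y)‖ ^ 2 ≤ 1 + r ^ 2 := by
  have hse : star e = e := he.isSelfAdjoint
  have hbound : ∀ z : M, ‖z‖ ≤ 1 → star z * z ≤ 1 := fun z hz => by
    rw [← CStarAlgebra.norm_le_one_iff_of_nonneg _ (star_mul_self_nonneg z),
      CStarRing.norm_star_mul_self]
    exact mul_le_one₀ hz (norm_nonneg _) hz
  have hw : 0 ≤ e - e * e := by
    have := (CStarAlgebra.pow_antitone he he1) one_le_two
    simp only [pow_one, sq] at this
    exact sub_nonneg.2 this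
  set z := e * x + (r : ℂ) • (y - e * y) with hz
  have key : star z * z + (star (x - (r : ℂ) • y) * (e - e * e) * (x - (r : ℂ) • y) +
      star x * (1 - e) * x + (r : ℂ) • (r : ℂ) • (star y * e * y)) =
      star x * x + (r : ℂ) • (r : ℂ) • (star y * y) := by
    simp only [hz, star_add, star_mul, star_smul, star_sub, hse, Complex.star_def,
      Complex.conj_ofReal, add_mul, mul_add, sub_mul, mul_sub, smul_mul_assoc, mul_smul_comm,
      smul_sub, smul_add, mul_assoc, one_mul]
    abel
  have hrr : ∀ v : M, (r : ℂ) • (r : ℂ) • v = (r ^ 2) • v := fun v => by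
    rw [smul_smul, ← Complex.ofReal_mul, Complex.coe_smul, sq]
  have hle : star z * z ≤ (1 + r ^ 2) • (1 : M) := by
    have h1 : star z * z ≤ star x * x + (r ^ 2) • (star y * y) := by
      rw [← hrr, ← key]
      refine le_add_of_nonneg_right (add_nonneg (add_nonneg (star_left_conjugate_nonneg hw _)
        (star_left_conjugate_nonneg (sub_nonneg.2 he1) _)) ?_)
      rw [hrr]
      exact smul_nonneg (by positivity) (star_left_conjugate_nonneg he _)
    refine h1.trans ?_
    rw [add_smul, one_smul]
    exact add_le_add (hbound x hx) (smul_le_smul_of_nonneg_left (hbound y hy) (by positivity))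
  rw [sq, ← CStarRing.norm_star_mul_self]
  refine (CStarAlgebra.norm_le_iff_le_algebraMap _ (by positivity) (star_mul_self_nonneg z)).2 ?_
  rwa [Algebra.algebraMap_eq_smul_one]

end

variable {𝔄 : Type*} [NonUnitalCStarAlgebra 𝔄]

/-- The left action of `𝔄` on its dual, `(a m)(f) = m (f a)`. -/
def left (a : 𝔄) (m : StrongDual ℂ 𝔄) : StrongDual ℂ 𝔄 :=
  m.comp ((ContinuousLinearMap.mul ℂ 𝔄).flip a)

/-- The right action of `𝔄` on its dual, `(m a)(f) = m (a f)`. -/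
def right (m : StrongDual ℂ 𝔄) (a : 𝔄) : StrongDual ℂ 𝔄 :=
  m.comp (ContinuousLinearMap.mul ℂ 𝔄 a)

theorem left_apply (a : 𝔄) (m : StrongDual ℂ 𝔄) (f : 𝔄) : left a m f = m (f * a) := rfl

theorem right_apply (a : 𝔄) (m : StrongDual ℂ 𝔄) (f : 𝔄) : right m a f = m (a * f) := rfl

/-- The map `m ↦ (a ↦ m a)` as a continuous linear map. -/
def rightL : StrongDual ℂ 𝔄 →L[ℂ] 𝔄 →L[ℂ] StrongDual ℂ 𝔄 :=
  ((ContinuousLinearMap.compL ℂ 𝔄 (𝔄 →L[ℂ] 𝔄) (StrongDual ℂ 𝔄)).flip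
    (ContinuousLinearMap.mul ℂ 𝔄)).comp (ContinuousLinearMap.compL ℂ 𝔄 𝔄 ℂ)

theorem rightL_apply (m : StrongDual ℂ 𝔄) (a : 𝔄) : rightL m a = right m a := rfl

/-- The Arens product of the bidual: `(F G)(m) = F (G m)`, where `(G m)(a) = G (m a)`. -/
def arens (F G : StrongDual ℂ (StrongDual ℂ 𝔄)) : StrongDual ℂ (StrongDual ℂ 𝔄) :=
  F.comp ((ContinuousLinearMap.compL ℂ 𝔄 (StrongDual ℂ 𝔄) ℂ G).comp rightL)

theorem arens_apply (F G : StrongDual ℂ (StrongDual ℂ 𝔄)) (m : StrongDual ℂ 𝔄) :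
    arens F G m = F (G.comp (rightL m)) := rfl

theorem norm_right_sub_le [PartialOrder 𝔄] [StarOrderedRing 𝔄] (m : StrongDual ℂ 𝔄) {e x : 𝔄}
    (he : 0 ≤ e) (he1 : ‖e‖ ≤ 1) (hx : ‖x‖ ≤ 1) {r : ℝ} (hr : 0 < r) :
    ‖right m e - m‖ ≤ (‖m‖ - ‖m x‖ + ‖m (e * x - x)‖) / r + ‖m‖ * r := by
  have hx' : ∀ u : ℂ, ‖u‖ = 1 → ∀ z : 𝔄, ‖z‖ ≤ 1 → ‖((u • z : 𝔄) : 𝔄⁺¹)‖ ≤ 1 := fun u hu z hz => by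
    rw [Unitization.norm_inr, norm_smul, hu, one_mul]; exact hz
  have hmx := m.le_opNorm x
  have hK : 0 ≤ (‖m‖ - ‖m x‖ + ‖m (e * x - x)‖) / r + ‖m‖ * r := by
    have : ‖m x‖ ≤ ‖m‖ := hmx.trans (mul_le_of_le_one_right (norm_nonneg _) hx)
    have : 0 ≤ ‖m‖ - ‖m x‖ + ‖m (e * x - x)‖ := by linarith [norm_nonneg (m (e * x - x))]
    positivity
  have key : ∀ y : 𝔄, ‖y‖ ≤ 1 → ‖(right m e - m) y‖ ≤
      (‖m‖ - ‖m x‖ + ‖m (e * x - x)‖) / r + ‖m‖ * r := by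
    intro y hy
    obtain ⟨u, hu, hu'⟩ := Complex.exists_norm_eq_mul_self (m x)
    obtain ⟨v, hv, hv'⟩ := Complex.exists_norm_eq_mul_self (m (y - e * y))
    have he' : (0 : 𝔄⁺¹) ≤ (e : 𝔄⁺¹) := Unitization.inr_nonneg_iff.2 he
    have he1' : (e : 𝔄⁺¹) ≤ 1 := by
      rw [← CStarAlgebra.norm_le_one_iff_of_nonneg _ he', Unitization.norm_inr]; exact he1
    have h1 := norm_comb_sq_le he' he1' (hx' u hu x hx) (hx' v hv y hy) r
    rw [← Unitization.inr_mul, ← Unitization.inr_mul, ← Unitization.inr_sub,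
      ← Unitization.inr_smul, ← Unitization.inr_add, Unitization.norm_inr] at h1
    set z := e * u • x + (r : ℂ) • (v • y - e * v • y) with hz
    have h2 : ‖z‖ ≤ 1 + r ^ 2 := by
      refine abs_le_of_sq_le_sq' (h1.trans ?_) (by positivity) |>.2
      nlinarith [sq_nonneg r, sq_nonneg (r ^ 2)]
    have h3 : m z = (‖m x‖ : ℂ) + r * (‖m (y - e * y)‖ : ℂ) + u * m (e * x - x) := by
      rw [hu', hv', hz]
      simp only [mul_smul_comm, ← smul_sub, map_add, map_smul, smul_eq_mul, map_sub]
      ring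
    have h4 : ‖m x‖ + r * ‖m (y - e * y)‖ ≤ ‖m z‖ + ‖m (e * x - x)‖ := by
      have e1 : ((‖m x‖ + r * ‖m (y - e * y)‖ : ℝ) : ℂ) = m z - u * m (e * x - x) := by
        rw [h3]; push_cast; ring
      have e2 : ‖((‖m x‖ + r * ‖m (y - e * y)‖ : ℝ) : ℂ)‖ = ‖m x‖ + r * ‖m (y - e * y)‖ := by
        rw [Complex.norm_real, Real.norm_of_nonneg (by positivity)]
      rw [← e2, e1]
      refine (norm_sub_le _ _).trans ?_
      rw [norm_mul, hu, one_mul]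
    have h5 : ‖m z‖ ≤ ‖m‖ * (1 + r ^ 2) := (m.le_opNorm z).trans (by gcongr)
    have h6 : ‖(right m e - m) y‖ = ‖m (y - e * y)‖ := by
      rw [sub_apply, right_apply, map_sub, norm_sub_rev]
    rw [h6, div_add' _ _ _ hr.ne', le_div_iff₀ hr]
    nlinarith
  refine ContinuousLinearMap.opNorm_le_bound _ hK fun y => ?_
  rcases eq_or_ne y 0 with rfl | hy0
  · simp
  have hy0' : 0 < ‖y‖ := norm_pos_iff.2 hy0
  have h7 := key (((‖y‖⁻¹ : ℝ) : ℂ) • y) (by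
    rw [norm_smul, Complex.norm_real, Real.norm_of_nonneg (by positivity),
      inv_mul_cancel₀ hy0'.ne'])
  rw [map_smul, norm_smul, Complex.norm_real, Real.norm_of_nonneg (by positivity),
    inv_mul_le_iff₀ hy0', mul_comm] at h7
  exact h7

theorem tendsto_right [PartialOrder 𝔄] [StarOrderedRing 𝔄] (m : StrongDual ℂ 𝔄) :
    Tendsto (fun e => right m e) (CStarAlgebra.approximateUnit 𝔄) (𝓝 m) := by
  have hap := CStarAlgebra.increasingApproximateUnit 𝔄
  refine Metric.tendsto_nhds.2 fun ε hε => ?_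
  obtain ⟨r, hr, hr'⟩ : ∃ r : ℝ, 0 < r ∧ ‖m‖ * r < ε / 3 := by
    refine ⟨ε / 3 / (‖m‖ + 1), by positivity, ?_⟩
    rw [← mul_div_assoc, div_lt_iff₀ (by positivity)]
    nlinarith [norm_nonneg m]
  obtain ⟨x, hx, hx'⟩ : ∃ x : 𝔄, ‖x‖ ≤ 1 ∧ ‖m‖ - ‖m x‖ < ε / 3 * r := by
    rcases eq_or_lt_of_le (norm_nonneg m) with h | h
    · exact ⟨0, by simp, by rw [← h]; simp; positivity⟩
    · obtain ⟨x, hx, hx'⟩ := m.exists_lt_apply_of_lt_opNorm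
        (show ‖m‖ - ε / 3 * r < ‖m‖ by linarith [mul_pos (div_pos hε three_pos) hr])
      exact ⟨x, hx.le, by linarith⟩
  have h1 : Tendsto (fun e => ‖m (e * x - x)‖) (CStarAlgebra.approximateUnit 𝔄) (𝓝 0) := by
    have := ((m.continuous.tendsto _).comp ((hap.tendsto_mul_right x).sub_const x)).norm
    simpa using this
  filter_upwards [hap.eventually_nonneg, hap.eventually_norm,
    h1.eventually_lt_const (show 0 < ε / 3 * r by positivity)] with e he he1 h2
  rw [dist_eq_norm]
  refine (norm_right_sub_le m he he1 hx hr).trans_lt ?_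
  have h3 : (‖m‖ - ‖m x‖ + ‖m (e * x - x)‖) / r < 2 * (ε / 3) := by
    rw [div_lt_iff₀ hr]; linarith
  linarith

theorem exists_one : ∃ e : StrongDual ℂ (StrongDual ℂ 𝔄),
    ∀ F, arens e F = F ∧ arens F e = F := by
  let _ := CStarAlgebra.spectralOrder 𝔄
  let _ := CStarAlgebra.spectralOrderedRing 𝔄
  let U := Ultrafilter.of (CStarAlgebra.approximateUnit 𝔄)
  have hU : (U : Filter 𝔄) ≤ CStarAlgebra.approximateUnit 𝔄 := Ultrafilter.of_le _
  have hap := CStarAlgebra.increasingApproximateUnit 𝔄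
  obtain ⟨e, he⟩ : ∃ e : StrongDual ℂ (StrongDual ℂ 𝔄),
      ∀ m : StrongDual ℂ 𝔄, Tendsto (fun a => m a) (U : Filter 𝔄) (𝓝 (e m)) := by
    have hc := WeakDual.isCompact_closedBall (𝕜 := ℂ) (E := StrongDual ℂ 𝔄) 0 1
    let ι : 𝔄 → WeakDual ℂ (StrongDual ℂ 𝔄) := fun a =>
      StrongDual.toWeakDual (NormedSpace.inclusionInDoubleDual ℂ 𝔄 a)
    obtain ⟨e, -, he⟩ := isCompact_iff_ultrafilter_le_nhds.1 hc (U.map ι) (by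
      rw [le_principal_iff]
      refine mem_of_superset (x := {a : 𝔄 | ‖a‖ ≤ 1}) (hU hap.eventually_norm) fun a ha => ?_
      refine mem_closedBall_zero_iff.2 ?_
      exact (NormedSpace.double_dual_bound ℂ 𝔄 a).trans ha)
    refine ⟨WeakDual.toStrongDual e, fun m => ?_⟩
    exact ((WeakDual.eval_continuous m).tendsto e).comp (tendsto_map'_iff.1 he)
  refine ⟨e, fun F => ⟨ContinuousLinearMap.ext fun m => ?_, ContinuousLinearMap.ext fun m => ?_⟩⟩
  · rw [arens_apply]
    exact tendsto_nhds_unique (he _) ((F.continuous.tendsto _).comp ((tendsto_right m).mono_left hU))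
  · rw [arens_apply]
    congr 1
    refine ContinuousLinearMap.ext fun a => ?_
    refine tendsto_nhds_unique (he (rightL m a)) ?_
    exact (m.continuous.tendsto _).comp ((hap.tendsto_mul_left a).mono_left hU)

/-- The unit `1` of the bidual `𝔄**`. -/
def bidualOne (𝔄 : Type*) [NonUnitalCStarAlgebra 𝔄] : StrongDual ℂ (StrongDual ℂ 𝔄) :=
  (exists_one (𝔄 := 𝔄)).choose

theorem bidualOne_spec (F : StrongDual ℂ (StrongDual ℂ 𝔄)) :
    arens (bidualOne 𝔄) F = F ∧ arens F (bidualOne 𝔄) = F :=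
  (exists_one (𝔄 := 𝔄)).choose_spec F

end CStarDual

end

noncomputable section

open scoped ENNReal NNReal Topology ComplexConjugate InnerProductSpace CStarAlgebra TensorProduct

namespace DirichletSpace

namespace RegularSubalgebra

variable {N : Type*} [CStarAlgebra N] [PartialOrder N] [StarOrderedRing N]
  {X : Type*} [NormedAddCommGroup X] [NormedSpace ℂ X] {D : DirichletSpace N X}
  (A : D.RegularSubalgebra)

/-- The carré du champ `Γ(a, c) ∈ 𝒜*`, `Γ(a, c)(f) = ⟪∂a, (∂c) f⟫`. -/
def Gamma (a c : A.B) : StrongDual ℂ A.alg :=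
  (innerSL ℂ (A.grad a)).comp
    ((ContinuousLinearMap.apply ℂ A.H (A.grad c)).comp A.rightAct)

theorem Gamma_apply (a c : A.B) (f : A.alg) :
    A.Gamma a c f = ⟪A.grad a, A.rightAct f (A.grad c)⟫_ℂ := rfl

/-- `R̂(a ⊗ b, c ⊗ d) = b* Γ(a, c) d ∈ 𝒜*`, for the `𝒜`-bimodule structure of `𝒜*`. -/
def Rhat (a b c d : A.B) : StrongDual ℂ A.alg :=
  CStarDual.right (CStarDual.left (A.incl (star b)) (A.Gamma a c)) (A.incl d)

theorem Rhat_apply (a b c d : A.B) (f : A.alg) :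
    A.Rhat a b c d f = A.Gamma a c (A.incl d * f * A.incl (star b)) := rfl

end RegularSubalgebra

end DirichletSpace

end

open scoped InnerProductSpace ComplexOrder

/-! ### The unit of the bidual and positive functionals. -/

namespace CStarDual

open Filter Topology

variable {𝔄 : Type*} [NonUnitalCStarAlgebra 𝔄]

/-! The extension has a closed formula: `R(h, g)(f) = ⟪h, g f⟫`, where `g f` is the right action of
`𝒜` on `ℋ`. This is the map `curv`. Because the right action is multiplicative and compatible with
the involutions (`rightAct_mul`, `inner_rightAct`), an algebra element can be moved from one side of
the inner product to the other. With `a ⊗ b = (∂a) b` this gives `⟪(∂a) b, (∂c) d f⟫ = ⟪∂a, (∂c)(d f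
b*)⟫`, which is the value of `b* Γ(a, c) d` at `f`. So `curv` restricts to `R̂` on elementary
tensors, and it is defined on the completed quotient from the start, which settles well-definedness
and continuity.

Positivity is the same computation on the diagonal: `⟪h, h f* f⟫ = ‖h f*‖²`. The mass formula rests
on two facts about an approximate unit `e` of `𝒜`. The unit of `𝒜**` is its weak-* limit
(`tendsto_bidualOne`), and `g e` tends to `g` in `ℋ` (`tendsto_rightAct`). Hence the mass of `R(h,
g)` is the limit of `⟪h, g e⟫`.

Both uniqueness claims reduce to `eq_curv`: elementary tensors span a dense subspace of `ℋ`, and the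
elements `f* f` span `𝒜`, so it suffices that each scalar form `(h, g) ↦ R(h, g)(f* f)` is
continuous. If `R` is continuous this is immediate. If `R` only satisfies properties 1 and 2,
continuity is automatic: a positive functional obeys `m(f* f) ≤ ‖f‖² m(1)` (`re_star_mul_self_le`),
so the form is bounded on the diagonal by `‖f‖² ‖h‖²`, and polarization (`norm_sesq_le_of_diag`)
turns this into boundedness off the diagonal. -/

theorem bidualOne_right (m : StrongDual ℂ 𝔄) (a : 𝔄) : bidualOne 𝔄 (right m a) = m a := by
  have h : (bidualOne 𝔄).comp (rightL m) = m := by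
    -- The identity `arens F 1 = F`, read at `m`, says that `F` takes equal values at the two
    -- functionals. Since `F` is an arbitrary element of the bidual and the bidual separates the
    -- points of the dual, they coincide.
    refine SeparatingDual.eq_iff_forall_dual_eq (R := ℂ) |>.2 fun F => ?_
    have := DFunLike.congr_fun (bidualOne_spec F).2 m
    rwa [arens_apply] at this
  exact DFunLike.congr_fun h a

/-- The unit of the bidual is the weak-* limit of the approximate unit. -/
theorem tendsto_bidualOne [PartialOrder 𝔄] [StarOrderedRing 𝔄] (m : StrongDual ℂ 𝔄) :
    Tendsto m (CStarAlgebra.approximateUnit 𝔄) (𝓝 (bidualOne 𝔄 m)) := by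
  -- The translates `m e` converge to `m` in norm, so the norm-continuous functional `bidualOne` may
  -- be applied to the limit. Its value on `m e` is the number `m(e)`.
  refine (((bidualOne 𝔄).continuous.tendsto m).comp (tendsto_right m)).congr fun a => ?_
  exact bidualOne_right m a

/-- The unit of the bidual is also the limit along the squares of the approximate unit. -/
theorem tendsto_bidualOne_star_mul_self [PartialOrder 𝔄] [StarOrderedRing 𝔄]
    (m : StrongDual ℂ 𝔄) :
    Tendsto (fun e => m (star e * e)) (CStarAlgebra.approximateUnit 𝔄) (𝓝 (bidualOne 𝔄 m)) := by
  have hap := CStarAlgebra.increasingApproximateUnit 𝔄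
  have h0 : Tendsto (fun e => ‖right m e - m‖) (CStarAlgebra.approximateUnit 𝔄) (𝓝 0) := by
    simpa using ((tendsto_right m).sub_const m).norm
  -- The argument `e` moves together with the functional, but it stays in the unit ball, so norm
  -- convergence of the functionals is enough.
  have h1 : Tendsto (fun e => (right m e - m) e) (CStarAlgebra.approximateUnit 𝔄) (𝓝 0) := by
    refine squeeze_zero_norm' ?_ h0
    filter_upwards [hap.eventually_norm] with e he
    exact ((right m e - m).le_opNorm e).trans (mul_le_of_le_one_right (norm_nonneg _) he)
  have h2 := h1.add (tendsto_bidualOne m)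
  rw [zero_add] at h2
  -- For self-adjoint `e` one has `m(e* e) = (m e - m)(e) + m(e)`, where the first term on the right
  -- tends to zero.
  refine h2.congr' ?_
  filter_upwards [hap.eventually_star_eq] with e he
  rw [sub_apply, right_apply, he, sub_add_cancel]

/-- A positive functional on a `C*`-algebra satisfies `m (f* f) ≤ ‖f‖² m(1)`, where `m(1)` is
evaluated in the bidual. -/
theorem re_star_mul_self_le {m : StrongDual ℂ 𝔄} (hm : ∀ f : 𝔄, 0 ≤ m (star f * f)) (f : 𝔄) :
    (m (star f * f)).re ≤ ‖f‖ ^ 2 * (bidualOne 𝔄 m).re := by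
  let _ := CStarAlgebra.spectralOrder 𝔄
  let _ := CStarAlgebra.spectralOrderedRing 𝔄
  have hap := CStarAlgebra.increasingApproximateUnit 𝔄
  have h1 : Tendsto (fun e => (m (star (f * e) * (f * e))).re) (CStarAlgebra.approximateUnit 𝔄)
      (𝓝 (m (star f * f)).re) := by
    have h := hap.tendsto_mul_left f
    exact (Complex.continuous_re.tendsto _).comp
      ((m.continuous.tendsto _).comp (((continuous_star.tendsto _).comp h).mul h))
  have h2 := ((Complex.continuous_re.tendsto _).comp
    -- The comparison below produces `m(e* e)` and not `m(e)`, which is why the limit along squares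
    -- is needed.
    (tendsto_bidualOne_star_mul_self m)).const_mul (‖f‖ ^ 2)
  refine le_of_tendsto_of_tendsto' h1 h2 fun e => ?_
  -- In a non-unital algebra `f* f ≤ ‖f‖² 1` has no meaning. It is compressed by `e` on both sides
  -- to `e* f* f e ≤ ‖f‖² e* e`, and the unit reappears in the limit as `bidualOne`.
  have h3 := CStarAlgebra.star_left_conjugate_le_norm_smul (a := e) (b := star f * f)
    (IsSelfAdjoint.star_mul_self f)
  -- Positivity of `m` is known only on elements of the form `g* g`, so the difference of the two
  -- sides is written in that form.
  obtain ⟨g, hg⟩ := exists_eq_star_mul_self (sub_nonneg.2 h3)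
  have h4 := (Complex.nonneg_iff.1 (hm g)).1
  rw [← hg, CStarRing.norm_star_mul_self, ← sq, map_sub, ← Complex.coe_smul, map_smul,
    Complex.sub_re, smul_eq_mul, Complex.re_ofReal_mul] at h4
  have h5 : star (f * e) * (f * e) = star e * (star f * f) * e := by
    rw [star_mul]; simp only [mul_assoc]
  rw [h5]
  exact sub_nonneg.1 h4

/-- Every element of a C*-algebra is a linear combination of positive ones, and each positive one is
some `f* f`. This lets the uniqueness arguments work with positive elements only, where positivity
yields bounds. -/
theorem ext_star_mul_self {m m' : StrongDual ℂ 𝔄}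
    (h : ∀ f : 𝔄, m (star f * f) = m' (star f * f)) : m = m' := by
  let _ := CStarAlgebra.spectralOrder 𝔄
  let _ := CStarAlgebra.spectralOrderedRing 𝔄
  refine ContinuousLinearMap.ext fun a => ?_
  have ha : a ∈ Submodule.span ℂ {x : 𝔄 | 0 ≤ x} := by
    rw [CStarAlgebra.span_nonneg]; trivial
  induction ha using Submodule.span_induction with
  | mem x hx =>
    obtain ⟨f, rfl⟩ := exists_eq_star_mul_self (show 0 ≤ x from hx)
    exact h f
  | zero => simp
  | add x y _ _ hx hy => rw [map_add, map_add, hx, hy]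
  | smul c x _ hx => rw [map_smul, map_smul, hx]

end CStarDual

/-! ### Boundedness of sesquilinear forms from their diagonal. -/

section Sesquilinear

variable {V : Type*} [NormedAddCommGroup V] [NormedSpace ℂ V]

/-- A sesquilinear form with bounded diagonal is bounded. -/
theorem norm_sesq_le_of_diag (S : V →ₗ⋆[ℂ] V →ₗ[ℂ] ℂ) {C : ℝ}
    (hS : ∀ h, ‖S h h‖ ≤ C * ‖h‖ ^ 2) (h g : V) : ‖S h g‖ ≤ 4 * C * ‖h‖ * ‖g‖ := by
  rcases eq_or_ne h 0 with rfl | hh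
  · simp
  rcases eq_or_ne g 0 with rfl | hg
  · simp
  -- The sign of `C` is not assumed; it follows from the diagonal bound at the nonzero vector `h`.
  -- On the zero space `C` could be negative, so the zero cases are removed beforehand.
  have hC : 0 ≤ C := by
    have h0 : 0 ≤ C * ‖h‖ ^ 2 := (norm_nonneg _).trans (hS h)
    exact nonneg_of_mul_nonneg_left h0 (pow_pos (norm_pos_iff.2 hh) 2)
  -- Polarization for a form antilinear in the first variable. It needs no Hermitian symmetry of
  -- `S`, so it applies to an arbitrary sesquilinear candidate.
  have polar : ∀ x y : V, S x y = (S (x + y) (x + y) - S (x - y) (x - y)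
      - Complex.I * S (x + Complex.I • y) (x + Complex.I • y)
      + Complex.I * S (x - Complex.I • y) (x - Complex.I • y)) / 4 := fun x y => by
    simp only [map_add, map_sub, LinearMap.add_apply, LinearMap.sub_apply, map_smulₛₗ,
      LinearMap.smul_apply, smul_eq_mul, RingHom.id_apply, Complex.conj_I]
    ring_nf
    simp only [Complex.I_sq]
    ring
  -- Each of the four vectors in the polarization formula has norm at most 2, so each diagonal term
  -- is at most `4 C`. Four of them divided by 4 give the constant `4 C`.
  have unit : ∀ x y : V, ‖x‖ ≤ 1 → ‖y‖ ≤ 1 → ‖S x y‖ ≤ 4 * C := fun x y hx hy => by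
    have hIy : ‖Complex.I • y‖ ≤ 1 := by rw [norm_smul, Complex.norm_I, one_mul]; exact hy
    have hq : ∀ z : V, ‖z‖ ≤ 2 → ‖S z z‖ ≤ C * 4 := fun z hz => by
      refine (hS z).trans (mul_le_mul_of_nonneg_left ?_ hC)
      nlinarith [norm_nonneg z]
    have h1 := hq _ ((norm_add_le x y).trans (by linarith))
    have h2 := hq _ ((norm_sub_le x y).trans (by linarith))
    have h3 := hq _ ((norm_add_le x (Complex.I • y)).trans (by linarith))
    have h4 := hq _ ((norm_sub_le x (Complex.I • y)).trans (by linarith))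
    rw [polar, norm_div, Complex.norm_ofNat, div_le_iff₀ (by norm_num)]
    refine (norm_add_le _ _).trans ?_
    refine (add_le_add_left (norm_sub_le _ _) _).trans ?_
    refine (add_le_add_left (add_le_add_left (norm_sub_le _ _) _) _).trans ?_
    rw [norm_mul, norm_mul, Complex.norm_I, one_mul, one_mul]
    linarith
  have hn : ∀ z : V, z ≠ 0 → ‖((‖z‖⁻¹ : ℝ) : ℂ) • z‖ ≤ 1 := fun z hz => by
    rw [norm_smul, Complex.norm_real, norm_inv, norm_norm, inv_mul_cancel₀ (norm_ne_zero_iff.2 hz)]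
  -- Homogeneity in each variable carries the bound from the normalized vectors back to `h` and `g`.
  have key := unit _ _ (hn h hh) (hn g hg)
  rw [map_smul, norm_smul, map_smulₛₗ, LinearMap.smul_apply, norm_smul, Complex.conj_ofReal,
    Complex.norm_real, Complex.norm_real, norm_inv, norm_inv, norm_norm, norm_norm,
    inv_mul_le_iff₀ (norm_pos_iff.2 hg), inv_mul_le_iff₀ (norm_pos_iff.2 hh)] at key
  linarith

/-- This is the automatic continuity behind the second uniqueness claim. The value of the constant
in the off-diagonal bound plays no role, only its existence. -/
theorem continuous_sesq_of_diag (S : V →ₗ⋆[ℂ] V →ₗ[ℂ] ℂ) {C : ℝ}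
    (hS : ∀ h, ‖S h h‖ ≤ C * ‖h‖ ^ 2) : Continuous fun p : V × V => S p.1 p.2 := by
  let T := S.mkContinuous₂ (4 * C) (norm_sesq_le_of_diag S hS)
  exact (T.continuous.comp continuous_fst).clm_apply continuous_snd

end Sesquilinear

/-! ### The right action of `𝒜` as a non-degenerate `*`-representation. -/

namespace DirichletSpace

namespace RegularSubalgebra

open Filter Topology

variable {N : Type*} [CStarAlgebra N] [PartialOrder N] [StarOrderedRing N]
  {X : Type*} [NormedAddCommGroup X] [NormedSpace ℂ X] {D : DirichletSpace N X}
  (A : D.RegularSubalgebra)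

theorem actB_mul (f g : A.B) (x : A.H) : A.actB (f * g) x = A.actB g (A.actB f x) := by
  refine UniformSpace.Completion.induction_on x (isClosed_eq (by fun_prop) (by fun_prop))
    fun x => ?_
  rw [actB_coe, actB_coe, actB_coe]
  congr 1
  refine A.pre_induction (p := fun x => A.pmulR (f * g) x = A.pmulR g (A.pmulR f x))
    (by simp) (fun a b => ?_) (fun x y hx hy => ?_) x
  · rw [pmulR_ptmul, pmulR_ptmul, pmulR_ptmul, mul_assoc]
  · rw [map_add, hx, hy, map_add, map_add]

/-- Both sides are continuous in `(f, g)`, so density of `ℬ` in `𝒜` reduces the claim to `actB_mul`,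
that is, to associativity in the second tensor factor. In `f * g` the factor `f` acts first, as
befits a right module. -/
theorem rightAct_mul (f g : A.alg) (x : A.H) :
    A.rightAct (f * g) x = A.rightAct g (A.rightAct f x) := by
  refine A.denseRange_inclL.induction_on₂
    (p := fun f g => A.rightAct (f * g) x = A.rightAct g (A.rightAct f x))
    (isClosed_eq (by fun_prop) (by fun_prop)) (fun f g => ?_) f g
  change A.rightAct (A.incl (f * g)) x = A.rightAct (A.incl g) (A.rightAct (A.incl f) x)
  rw [rightAct_incl, rightAct_incl, rightAct_incl, actB_mul]

/-- On `ℬ` this is `inner_actB`, and density does the rest. It is the property that makes `⟪h, g f⟫`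
both positive on the diagonal and compatible with the bimodule structure of `𝒜*`. -/
theorem inner_rightAct (f : A.alg) (x y : A.H) :
    ⟪A.rightAct f x, y⟫_ℂ = ⟪x, A.rightAct (star f) y⟫_ℂ := by
  refine A.denseRange_inclL.induction_on
    (p := fun f => ⟪A.rightAct f x, y⟫_ℂ = ⟪x, A.rightAct (star f) y⟫_ℂ) f
    (isClosed_eq (by fun_prop) (by fun_prop)) fun f => ?_
  change ⟪A.rightAct (A.incl f) x, y⟫_ℂ = ⟪x, A.rightAct (A.incl (star f)) y⟫_ℂ
  rw [rightAct_incl, rightAct_incl, inner_actB]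

/-- The constant 1 is inherited from `norm_actB_le`. An approximate unit in the unit ball therefore
acts by contractions. -/
theorem norm_rightAct_le (f : A.alg) (x : A.H) : ‖A.rightAct f x‖ ≤ ‖f‖ * ‖x‖ := by
  refine A.denseRange_inclL.induction_on (p := fun f => ‖A.rightAct f x‖ ≤ ‖f‖ * ‖x‖) f
    (isClosed_le (by fun_prop) (by fun_prop)) fun f => ?_
  change ‖A.rightAct (A.incl f) x‖ ≤ _
  rw [rightAct_incl]
  exact (A.actB f).le_of_opNorm_le (A.norm_actB_le f) x

/-- The right action of `𝒜` on `ℋ` is non-degenerate: approximate units act as such. -/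
theorem tendsto_rightAct {l : Filter A.alg} (hl : ∀ᶠ e in l, ‖e‖ ≤ 1)
    (hl' : ∀ f : A.alg, Tendsto (fun e => f * e) l (𝓝 f)) (x : A.H) :
    Tendsto (fun e => A.rightAct e x) l (𝓝 x) := by
  have hpre : ∀ z : A.PreTangent, Tendsto (fun e => A.rightAct e (z : A.H)) l (𝓝 (z : A.H)) := by
    refine fun z => A.pre_induction
      (p := fun z => Tendsto (fun e => A.rightAct e (z : A.H)) l (𝓝 (z : A.H))) ?_ ?_ ?_ z
    · simp only [UniformSpace.Completion.coe_zero, map_zero]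
      exact tendsto_const_nhds
    · intro a b
      change Tendsto (fun e => A.rightAct e (A.tmul a b)) l (𝓝 (A.tmul a b))
      -- Writing `a ⊗ b = (∂a) b` turns the action of `e` into `(∂a)(b e)`, so convergence in `ℋ`
      -- follows from `b e → b` in `𝒜`. The direct formula `a ⊗ (b e)` is not available, as `e` need
      -- not lie in `ℬ`.
      rw [← A.grad_mul]
      have h : Continuous fun f : A.alg => A.rightAct f (A.grad a) := by fun_prop
      exact ((h.tendsto _).comp (hl' (A.incl b))).congr fun e => A.rightAct_mul _ _ _
    · intro y z hy hz
      simpa only [UniformSpace.Completion.coe_add, map_add] using hy.add hz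
  -- Strong convergence on a dense subspace passes to all of `ℋ` because the operators involved are
  -- eventually contractions: `x` is replaced by a nearby `z`, at a cost of less than `ε / 3` on
  -- each side.
  refine Metric.tendsto_nhds.2 fun ε hε => ?_
  obtain ⟨z, hz⟩ := UniformSpace.Completion.denseRange_coe.exists_dist_lt x
    (show 0 < ε / 3 by positivity)
  filter_upwards [hl, Metric.tendsto_nhds.1 (hpre z) (ε / 3) (by positivity)] with e he hez
  have h1 : dist (A.rightAct e x) (A.rightAct e z) < ε / 3 := by
    rw [dist_eq_norm, ← map_sub]
    rw [dist_eq_norm] at hz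
    exact ((A.norm_rightAct_le e _).trans (mul_le_of_le_one_left (norm_nonneg _) he)).trans_lt hz
  have h2 := dist_triangle4 (A.rightAct e x) (A.rightAct e z) z x
  rw [dist_comm (z : A.H) x] at h2
  linarith

/-! ### The extension `R` and its properties. -/

/-- The functional `f ↦ ⟪h, g f⟫` on `𝒜`, as a sesquilinear function of `(h, g)`. -/
noncomputable def curv : A.H →ₗ⋆[ℂ] A.H →ₗ[ℂ] StrongDual ℂ A.alg :=
  LinearMap.mk₂'ₛₗ (starRingEnd ℂ) (RingHom.id ℂ)
    (fun h g => (innerSL ℂ h).comp ((ContinuousLinearMap.apply ℂ A.H g).comp A.rightAct))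
    (fun h h' g => by ext f; simp)
    (fun c h g => by ext f; simp)
    (fun h g g' => by ext f; simp)
    (fun c h g => by ext f; simp)

theorem curv_apply (h g : A.H) (f : A.alg) : A.curv h g f = ⟪h, A.rightAct f g⟫_ℂ := rfl

/-- Continuity is joint and for the norm of `𝒜*`: `curv` is composed of bounded operations, namely
the inner product, evaluation at a vector, and the action. -/
theorem continuous_curv : Continuous fun p : A.H × A.H => A.curv p.1 p.2 := by
  have h : Continuous fun p : A.H × A.H => (innerSL ℂ p.1).comp
      ((ContinuousLinearMap.apply ℂ A.H p.2).comp A.rightAct) := by fun_prop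
  exact h

/-- After substituting `(∂a) b` and `(∂c) d`, the factor `b` crosses the inner product as `b*`. It
then acts last on the right-hand vector, giving `(∂c)(d f b*)`, the argument at which `R̂` evaluates
`Γ(a, c)`. -/
theorem curv_tmul (a b c d : A.B) : A.curv (A.tmul a b) (A.tmul c d) = A.Rhat a b c d := by
  ext f
  have hs : A.incl (star b) = star (A.incl b) := rfl
  rw [curv_apply, Rhat_apply, Gamma_apply, ← A.grad_mul a b, ← A.grad_mul c d, inner_rightAct,
    rightAct_mul, rightAct_mul, hs]

/-- Here `h (f* f) = (h f*) f`, and the last `f` crosses to the left as `f*`, so the value is `‖h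
f*‖²`. -/
theorem curv_self_nonneg (h : A.H) (f : A.alg) : 0 ≤ A.curv h h (star f * f) := by
  rw [curv_apply, rightAct_mul, ← star_star f, ← inner_rightAct, star_star,
    inner_self_eq_norm_sq_to_K, ← RCLike.ofReal_pow]
  exact Complex.zero_le_real.2 (sq_nonneg _)

/-- The numbers `⟪h, g e⟫` have two limits along the approximate unit: the value of `bidualOne` on
the functional, and `⟪h, g⟫` by non-degeneracy of the action. -/
theorem bidualOne_curv (h g : A.H) : CStarDual.bidualOne A.alg (A.curv h g) = ⟪h, g⟫_ℂ := by
  let _ := CStarAlgebra.spectralOrder A.alg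
  let _ := CStarAlgebra.spectralOrderedRing A.alg
  have hap := CStarAlgebra.increasingApproximateUnit A.alg
  exact tendsto_nhds_unique (CStarDual.tendsto_bidualOne (A.curv h g))
    ((tendsto_const_nhds (x := h)).inner (𝕜 := ℂ)
      (A.tendsto_rightAct hap.eventually_norm hap.tendsto_mul_left g))

/-! ### Uniqueness of the extension. -/

/-- A sesquilinear map on `ℋ` that agrees with `curv` on elementary tensors, and is continuous
after evaluation at each `f* f`, is `curv`. -/
theorem eq_curv (R : A.H →ₗ⋆[ℂ] A.H →ₗ[ℂ] StrongDual ℂ A.alg)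
    (hR : ∀ a b c d : A.B, R (A.tmul a b) (A.tmul c d) = A.Rhat a b c d)
    (hc : ∀ f : A.alg, Continuous fun p : A.H × A.H => R p.1 p.2 (star f * f)) :
    R = A.curv := by
  -- This part is purely algebraic: agreement on elementary tensors propagates to finite sums by
  -- additivity in each variable, with no continuity used.
  have hpre : ∀ x y : A.PreTangent, R (x : A.H) (y : A.H) = A.curv (x : A.H) (y : A.H) := by
    intro x y
    refine A.pre_induction
      (p := fun x => R (x : A.H) (y : A.H) = A.curv (x : A.H) (y : A.H)) ?_ ?_ ?_ x
    · simp only [UniformSpace.Completion.coe_zero, map_zero, LinearMap.zero_apply]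
    · intro a b
      refine A.pre_induction (p := fun y => R (A.tmul a b) (y : A.H) =
        A.curv (A.tmul a b) (y : A.H)) ?_ ?_ ?_ y
      · simp only [UniformSpace.Completion.coe_zero, map_zero]
      · intro c d
        exact (hR a b c d).trans (A.curv_tmul a b c d).symm
      · intro y z hy hz
        rw [UniformSpace.Completion.coe_add, map_add, map_add, hy, hz]
    · intro x z hx hz
      rw [UniformSpace.Completion.coe_add, map_add, map_add, LinearMap.add_apply,
        LinearMap.add_apply, hx, hz]
  -- Two functionals are compared on the elements `f* f` alone, since continuity of `R` is available
  -- only after evaluation there. For each fixed `f` the two scalar forms are continuous and agree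
  -- on a dense set of pairs.
  refine LinearMap.ext fun h => LinearMap.ext fun g => CStarDual.ext_star_mul_self fun f => ?_
  have h1 : Continuous fun p : A.H × A.H => A.curv p.1 p.2 (star f * f) :=
    A.continuous_curv.clm_apply continuous_const
  refine UniformSpace.Completion.induction_on₂ h g (isClosed_eq (hc f) h1) fun x y => ?_
  rw [hpre]

/-- A sesquilinear map that is positive on the diagonal with mass `‖h‖²` is continuous after
evaluation at each `f* f`. -/
theorem continuous_apply_star_mul_self (R : A.H →ₗ⋆[ℂ] A.H →ₗ[ℂ] StrongDual ℂ A.alg)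
    (hpos : ∀ (h : A.H) (f : A.alg), 0 ≤ R h h (star f * f))
    (hone : ∀ h g : A.H, CStarDual.bidualOne A.alg (R h g) = ⟪h, g⟫_ℂ) (f : A.alg) :
    Continuous fun p : A.H × A.H => R p.1 p.2 (star f * f) := by
  let S : A.H →ₗ⋆[ℂ] A.H →ₗ[ℂ] ℂ := LinearMap.mk₂'ₛₗ (starRingEnd ℂ) (RingHom.id ℂ)
    (fun h g => R h g (star f * f)) (by simp) (by simp) (by simp) (by simp)
  -- The constant is the one in `re_star_mul_self_le`: the functional `R(h, h)` is positive and has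
  -- mass `⟪h, h⟫ = ‖h‖²`, so its value at `f* f` is at most `‖f‖² ‖h‖²`.
  refine continuous_sesq_of_diag S (C := ‖f‖ ^ 2) fun h => ?_
  have h1 := CStarDual.re_star_mul_self_le (hpos h) f
  have h2 : (⟪h, h⟫_ℂ).re = ‖h‖ ^ 2 := inner_self_eq_norm_sq (𝕜 := ℂ) h
  rw [hone, h2] at h1
  change ‖R h h (star f * f)‖ ≤ _
  -- A nonnegative complex number equals its modulus, so the bound on the real part already bounds
  -- the norm.
  rwa [← Complex.re_eq_norm.2 (hpos h f)]

end RegularSubalgebra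

end DirichletSpace

/-- Well-definedness is carried by the type of `R`: `A.H` is a Hausdorff completion, in which null
vectors of `ℬ ⊗ ℬ` are already zero. The last clause imposes no continuity on `R'`; its two
conditions force enough of it. -/
theorem mainTheorem1 {N : Type*} [CStarAlgebra N] [PartialOrder N] [StarOrderedRing N]
    {X : Type*} [NormedAddCommGroup X] [NormedSpace ℂ X] [CompleteSpace X]
    (D : DirichletSpace N X) (A : D.RegularSubalgebra) :
    ∃ R : A.H →ₗ⋆[ℂ] A.H →ₗ[ℂ] StrongDual ℂ A.alg,
      (∀ a b c d : A.B, R (A.tmul a b) (A.tmul c d) = A.Rhat a b c d) ∧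
      Continuous (fun p : A.H × A.H => R p.1 p.2) ∧
      (∀ (h : A.H) (f : A.alg), 0 ≤ R h h (star f * f)) ∧
      (∀ h g : A.H, CStarDual.bidualOne A.alg (R h g) = ⟪h, g⟫_ℂ) ∧
      (∀ R' : A.H →ₗ⋆[ℂ] A.H →ₗ[ℂ] StrongDual ℂ A.alg,
        (∀ a b c d : A.B, R' (A.tmul a b) (A.tmul c d) = A.Rhat a b c d) →
        Continuous (fun p : A.H × A.H => R' p.1 p.2) → R' = R) ∧
      (∀ R' : A.H →ₗ⋆[ℂ] A.H →ₗ[ℂ] StrongDual ℂ A.alg,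
        (∀ a b c d : A.B, R' (A.tmul a b) (A.tmul c d) = A.Rhat a b c d) →
        (∀ (h : A.H) (f : A.alg), 0 ≤ R' h h (star f * f)) →
        (∀ h g : A.H, CStarDual.bidualOne A.alg (R' h g) = ⟪h, g⟫_ℂ) → R' = R) := by
  refine ⟨A.curv, A.curv_tmul, A.continuous_curv, A.curv_self_nonneg, A.bidualOne_curv,
    -- Both uniqueness clauses go through `eq_curv` and differ only in how continuity at `f* f` is
    -- obtained: here by evaluating a norm-continuous map, in the next line from positivity and
    -- mass.
    fun R hR hc => A.eq_curv R hR fun f => hc.clm_apply continuous_const,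
    fun R hR hpos hone => A.eq_curv R hR (A.continuous_apply_star_mul_self R hpos hone)⟩
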